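/- Let $F=(f_1,f_2,f_3):\mathbb R^5\to\mathbb R^3$ be the polynomial map given in coordinates $(x,y,z,u,v)$ by \[ \begin{aligned} f_1&=y^2+(u^2x+1)(vx-1)\bigl(x^2+(v-u^2)x+1\bigr),\\ f_2&=(z^2+u^2)-v(u^2+1)(z^2+1),\\ f_3&=u, \end{aligned} \] and let $\delta=\{(0,0,u)\in\mathbb R^3 : u\in[0,1]\}$. Then: 1. $F$ has no singular point over $\delta$: the differential $dF_w:\mathbb R^5\to\mathbb R^3$ is surjective at every $w\in F^{-1}(\delta)$. 2. For every $t\in\delta$ (including $t=0$) the fiber $F^{-1}(t)$ is diffeomorphic to $S^1\times\mathbb R$. In particular $H_n(F^{-1}(t);\mathbb Z)\cong H_n(F^{-1}(0);\mathbb Z)$ for all $t\in\delta$ and all $n\ge 0$. 3. For every base point $x_0\in F^{-1}(0)$ the relative homotopy group $\pi_2(F^{-1}(\delta),F^{-1}(0),x_0)$ is non-trivial. 4. The restriction $F|_{F^{-1}(\delta)}:F^{-1}(\delta)\to\delta$ is not a Serre fibration. 5. The fiber over $0$ is atypical, both for $F$ and for $F|_{F^{-1}(\delta)}:F^{-1}(\delta)\to\delta$: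 there is no open neighborhood $U$ of $0$ in the target ($\mathbb R^3$, respectively $\delta$) over which the map is a (topologically) locally trivial fibration. -/

import Mathlib

open scoped unitInterval Topology ContDiff

noncomputable section

/-- Smoothness of a map on an arbitrary subset `X` of a normed space, in the usual sense: near each
point of `X` the map agrees on `X` with a `C^∞` map defined on an open set of the ambient space. -/
def SmoothOnSubset {E E' : Type*} [NormedAddCommGroup E] [NormedSpace ℝ E]
    [NormedAddCommGroup E'] [NormedSpace ℝ E'] (f : E → E') (X : Set E) : Prop :=
  ∀ x ∈ X, ∃ U : Set E, IsOpen U ∧ x ∈ U ∧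
    ∃ g : E → E', ContDiffOn ℝ ∞ g U ∧ Set.EqOn g f (U ∩ X)

/-- Two subsets `X ⊆ E` and `Y ⊆ E'` are diffeomorphic: there are mutually inverse smooth maps
`X → Y` and `Y → X` (the values of `f` outside `X` and of `g` outside `Y` are irrelevant). -/
def DiffeomorphicSubsets {E E' : Type*} [NormedAddCommGroup E] [NormedSpace ℝ E]
    [NormedAddCommGroup E'] [NormedSpace ℝ E'] (X : Set E) (Y : Set E') : Prop :=
  ∃ (f : E → E') (g : E' → E), Set.MapsTo f X Y ∧ Set.MapsTo g Y X ∧ Set.InvOn g f X Y ∧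
    SmoothOnSubset f X ∧ SmoothOnSubset g Y

/-- The cylinder `S¹ × ℝ`, as a subset of `ℂ × ℝ`. -/
def cylinder : Set (ℂ × ℝ) := Metric.sphere (0 : ℂ) 1 ×ˢ Set.univ

/-- A Serre fibration: a continuous map with the homotopy lifting property for all cubes
`[0,1]^n`, `n ≥ 0`. -/
def IsSerreFibration {E B : Type*} [TopologicalSpace E] [TopologicalSpace B] (p : E → B) : Prop :=
  Continuous p ∧ ∀ (n : ℕ) (f : C(I^ Fin n, E)) (H : C(I × (I^ Fin n), B)),
    (∀ y, H (0, y) = p (f y)) →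
      ∃ K : C(I × (I^ Fin n), E), (∀ y, K (0, y) = f y) ∧ ∀ s, p (K s) = H s

/-- A locally trivial fibration (in the topological category): every point `b` of the base has an
open neighbourhood `V` over which the map is isomorphic to a projection `V × Fib → V`; the fiber
is allowed to depend on `b`. -/
def IsLocallyTrivialFibration {E B : Type} [TopologicalSpace E] [TopologicalSpace B]
    (p : E → B) : Prop :=
  ∀ b : B, ∃ (Fib : Type) (_ : TopologicalSpace Fib) (e : Bundle.Trivialization Fib p), b ∈ e.baseSet

/-- The fiber `p⁻¹(b)` is atypical: there is no open neighbourhood `U` of `b` such that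
`p : p⁻¹(U) → U` is a locally trivial fibration. -/
def IsAtypicalFiber {E B : Type} [TopologicalSpace E] [TopologicalSpace B]
    (p : E → B) (b : B) : Prop :=
  ¬ ∃ U : Set B, IsOpen U ∧ b ∈ U ∧ IsLocallyTrivialFibration (U.restrictPreimage p)

/-- For a cube `I^N` with a distinguished coordinate `j`, the closure of the complement in `∂I^N` of
the face `y j = 0`. -/
def Cube.outerFaces {N : Type*} (j : N) : Set (I^N) :=
  {y | y j = 1 ∨ ∃ i, i ≠ j ∧ (y i = 0 ∨ y i = 1)}

/-- Maps of triples `(I^N, ∂I^N, J) → (X, A, x₀)`, where `J` is the union of all the faces other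
than the face `y j = 0`. -/
def RelGenLoop {N : Type*} (j : N) {X : Type*} [TopologicalSpace X] (A : Set X) (x₀ : A) :
    Set C(I^N, X) :=
  {g | (∀ y ∈ Cube.boundary N, g y ∈ A) ∧ ∀ y ∈ Cube.outerFaces j, g y = (x₀ : X)}

/-- Homotopy through maps of triples `(I^N, ∂I^N, J) → (X, A, x₀)`. -/
def RelGenLoop.setoid {N : Type*} (j : N) {X : Type*} [TopologicalSpace X] (A : Set X) (x₀ : A) :
    Setoid (RelGenLoop j A x₀) where
  r f g := ContinuousMap.HomotopicWith f.1 g.1 (fun h => h ∈ RelGenLoop j A x₀)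
  iseqv :=
    { refl := fun f => ContinuousMap.HomotopicWith.refl f.1 f.2
      symm := fun h => ContinuousMap.HomotopicWith.symm h
      trans := fun h₁ h₂ => ContinuousMap.HomotopicWith.trans h₁ h₂ }

/-- The underlying set of the relative homotopy group `π_n(X, A, x₀)`, `n ≥ 1`: homotopy classes of
maps `(I^n, ∂I^n, J) → (X, A, x₀)`, where the distinguished face is `{last coordinate = 0}`.
The cube dimension is written `n = m + 1`. The group is trivial exactly when this set has only one
element. -/
def RelHomotopyGroup (m : ℕ) {X : Type*} [TopologicalSpace X] (A : Set X) (x₀ : A) : Type _ :=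
  Quotient (RelGenLoop.setoid (Fin.last m) A x₀)

/-- `π_2(X, A, x₀)`. -/
abbrev RelPi2 {X : Type*} [TopologicalSpace X] (A : Set X) (x₀ : A) : Type _ :=
  RelHomotopyGroup 1 A x₀

/-- The integral singular homology group `H_n(X; ℤ)` of a subset `X` of a topological space. -/
abbrev integralHomology (n : ℕ) {E : Type} [TopologicalSpace E] (X : Set E) : ModuleCat.{0} ℤ :=
  ((AlgebraicTopology.singularHomologyFunctor (ModuleCat.{0} ℤ) n).obj (ModuleCat.of ℤ ℤ)).obj
    (TopCat.of X)

/-- The polynomial map `F : ℝ⁵ → ℝ³`, in the coordinates `(x, y, z, u, v)`. -/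
def exampleMap (w : Fin 5 → ℝ) : Fin 3 → ℝ :=
  let x := w 0
  let y := w 1
  let z := w 2
  let u := w 3
  let v := w 4
  ![y ^ 2 + (u ^ 2 * x + 1) * (v * x - 1) * (x ^ 2 + (v - u ^ 2) * x + 1),
    (z ^ 2 + u ^ 2) - v * (u ^ 2 + 1) * (z ^ 2 + 1),
    u]

/-- The arc `δ = {(0, 0, u) : u ∈ [0, 1]}` in `ℝ³`. -/
def exampleArc : Set (Fin 3 → ℝ) := {t | ∃ u ∈ Set.Icc (0 : ℝ) 1, t = ![0, 0, u]}

theorem zero_mem_exampleArc : (0 : Fin 3 → ℝ) ∈ exampleArc :=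
  ⟨0, by simp, by ext i; fin_cases i <;> rfl⟩

/-- The restriction `F⁻¹(δ) → δ` of `F`. -/
abbrev exampleRestriction : exampleMap ⁻¹' exampleArc → exampleArc :=
  exampleArc.restrictPreimage exampleMap

/-- The fiber `F⁻¹(0)` as a subset of the space `F⁻¹(δ)`. -/
abbrev exampleZeroFiber : Set (exampleMap ⁻¹' exampleArc) :=
  {w | exampleMap w = 0}

end

/-! Over `(0, 0, c)` the equations give `u = c` and express `v ∈ [0, 1]` through `z`. The factor `Q
= x² + (v - c²)x + 1` is positive, so with `w = y / √Q` what remains is the conic `w² = (1 + c²x)(1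
- vx)` for each `z`. For `0 < c ≤ 1` it is an ellipse, and the fiber is a cylinder with height `z`.
For `c = 0` it is a parabola when `z ≠ 0` and the pair of lines `w = ±1` when `z = 0`. Here `(w, z)`
never vanishes, and its angle together with a modified `x` identifies the fiber with a cylinder
again.

The fibers are thus diffeomorphic, but they do not fit together. As `c → 0` both vertices `x =
-1/c²` and `x = 1/v` of the ellipse at `z = 0` run off to infinity. A loop in the zero fiber that
winds once around `(w, z) = 0` is essential there, yet it bounds a disc over `u ∈ [0, ε]`, for every
`ε ∈ (0, 1]`, that closes up through the far vertex `x = 1/v`. This is `exampleDisc ε`, and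
`exampleDetector` certifies the winding of its boundary.

The topological conclusions follow formally from these discs (`IsEssentialDisc`). The boundary loop
makes the relative `π₂` non-trivial (`IsEssentialDisc.nontrivial_relPi2`). A Serre fibration
(`IsEssentialDisc.not_isSerreFibration`) or a local trivialization
(`isAtypicalFiber_of_essentialDisc`) would push a disc into the zero fiber and so kill an essential
loop. Winding is measured by lifting through the covering `exp`. -/

/-! ### Winding numbers as increments of logarithms. -/

/-- The nowhere vanishing loop or path `γ` has a continuous logarithm whose endpoints differ
by `c`. -/
def HasLogIncrement (γ : I → ℂ) (c : ℂ) : Prop :=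
  ∃ θ : I → ℂ, Continuous θ ∧ (∀ s, Complex.exp (θ s) = γ s) ∧ θ 1 - θ 0 = c

theorem eq_of_exp_eq {θ θ' : I → ℂ} (h : Continuous θ) (h' : Continuous θ')
    (he : ∀ s, Complex.exp (θ s) = Complex.exp (θ' s)) (h0 : θ 0 = θ' 0) : θ = θ' :=
  Complex.isCoveringMap_exp.eq_of_comp_eq h h' (funext fun s => Subtype.ext (he s)) 0 h0

theorem HasLogIncrement.eq_zero_of_const {γ : I → ℂ} {c : ℂ} (h : HasLogIncrement γ c)
    (hγ : ∀ s, γ s = γ 0) : c = 0 := by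
  obtain ⟨θ, hθ, he, rfl⟩ := h
  have := eq_of_exp_eq hθ (continuous_const (y := θ 0)) (fun s => by rw [he, he, hγ]) rfl
  rw [congrFun this 1, sub_self]

/-- The increment of the logarithm of a loop is invariant under free homotopy. -/
theorem HasLogIncrement.of_homotopy {h : I × I → ℂ} {c : ℂ} (hc : Continuous h)
    (hne : ∀ x, h x ≠ 0) (hl : ∀ t, h (t, 0) = h (t, 1))
    (h0 : HasLogIncrement (fun s => h (0, s)) c) : HasLogIncrement (fun s => h (1, s)) c := by
  obtain ⟨θ, hθ, he, rfl⟩ := h0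
  let H : C(I × I, {z : ℂ // z ≠ 0}) := ⟨fun x => ⟨h x, hne x⟩, by fun_prop⟩
  have H0 : ∀ s, H (0, s) = ⟨_, Complex.exp_ne_zero ((⟨θ, hθ⟩ : C(I, ℂ)) s)⟩ :=
    fun s => Subtype.ext (he s).symm
  let Θ := Complex.isCoveringMap_exp.liftHomotopy H ⟨θ, hθ⟩ H0
  have hΘ : ∀ x, Complex.exp (Θ x) = h x := fun x =>
    congrArg Subtype.val (congrFun (Complex.isCoveringMap_exp.liftHomotopy_lifts H ⟨θ, hθ⟩ H0) x)
  have hΘ0 : ∀ s, Θ (0, s) = θ s := Complex.isCoveringMap_exp.liftHomotopy_zero H ⟨θ, hθ⟩ H0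
  have hexp : Complex.exp (θ 1 - θ 0) = 1 := by
    simp only [Complex.exp_sub, he, hl, div_self (hne _)]
  -- Both sides are logarithms of the same path `h (·, 0) = h (·, 1)` and agree at `t = 0`, so the
  -- increment does not depend on `t`.
  have key : (fun t => Θ (t, 1)) = fun t => Θ (t, 0) + (θ 1 - θ 0) := by
    refine eq_of_exp_eq (by fun_prop) (by fun_prop) (fun t => ?_) ?_
    · rw [Complex.exp_add, hexp, hΘ, hΘ, hl, mul_one]
    · simp [hΘ0]
  refine ⟨fun s => Θ (1, s), by fun_prop, fun s => hΘ _, ?_⟩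
  exact sub_eq_of_eq_add' (congrFun key 1)

/-- The point of the unit circle with angle `2πs`. -/
noncomputable def circlePoint (s : ℝ) : ℂ := Complex.exp (2 * Real.pi * Complex.I * s)

@[fun_prop]
theorem continuous_circlePoint : Continuous circlePoint := by
  unfold circlePoint; fun_prop

theorem circlePoint_zero : circlePoint 0 = 1 := by simp [circlePoint]

theorem circlePoint_one : circlePoint 1 = 1 := by simp [circlePoint]

theorem norm_circlePoint (s : ℝ) : ‖circlePoint s‖ = 1 := by
  rw [circlePoint, Complex.norm_exp]; simp

theorem hasLogIncrement_circlePoint {f : I → ℝ} (hf : Continuous f) (h0 : f 0 = 0)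
    (h1 : f 1 = 1) :
    HasLogIncrement (fun s => circlePoint (f s)) (2 * Real.pi * Complex.I) :=
  ⟨fun s => 2 * Real.pi * Complex.I * f s, by fun_prop, fun s => rfl, by simp [h0, h1]⟩

/-! ### Essential discs as obstructions to fibrations. -/

/-- A map of the plane into `X` that sends the complement of the open unit disc into `A`, whose
restriction to the unit circle is a loop in `A` that a nowhere vanishing function `φ` on `A` detects. -/
structure IsEssentialDisc {X : Type*} [TopologicalSpace X] (A : Set X) (φ : X → ℂ)
    (G : ℂ → X) : Prop where
  continuousOn : ContinuousOn φ A
  ne_zero : ∀ x ∈ A, φ x ≠ 0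
  continuous : Continuous G
  mem : ∀ ζ, 1 ≤ ‖ζ‖ → G ζ ∈ A
  apply : ∀ ζ, ‖ζ‖ = 1 → φ (G ζ) = ζ

section
variable {X : Type*} [TopologicalSpace X] {A : Set X} {φ : X → ℂ} {G : ℂ → X}

/-- A loop in `A` that extends to a map of the disc into `A` is not detected. -/
theorem eq_zero_of_extends (hφ : ContinuousOn φ A) (hne : ∀ x ∈ A, φ x ≠ 0) {D : ℂ → X}
    (hD : ContinuousOn D (Metric.closedBall 0 1)) (hDA : ∀ ζ, ‖ζ‖ ≤ 1 → D ζ ∈ A) {c : ℂ}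
    (hc : HasLogIncrement (fun s => φ (D (circlePoint s))) c) : c = 0 := by
  have hb : ∀ x : I × I, ‖(1 - (x.1 : ℝ) : ℂ) * circlePoint x.2‖ ≤ 1 := fun x => by
    rw [norm_mul, norm_circlePoint, mul_one, ← Complex.ofReal_one, ← Complex.ofReal_sub,
      Complex.norm_real, Real.norm_eq_abs, abs_le]
    constructor <;> linarith [x.1.2.1, x.1.2.2]
  have hcont : Continuous fun x : I × I => φ (D ((1 - (x.1 : ℝ) : ℂ) * circlePoint x.2)) :=
    hφ.comp_continuous (hD.comp_continuous (by fun_prop) fun x => by simpa using hb x)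
      fun x => hDA _ (hb x)
  -- Shrinking the circle radially to the center of the disc contracts the loop.
  refine (HasLogIncrement.of_homotopy hcont (fun x => hne _ (hDA _ (hb x))) (fun t => ?_)
    (c := c) ?_).eq_zero_of_const fun s => ?_
  · simp [circlePoint_zero, circlePoint_one]
  · simpa using hc
  · simp

theorem IsEssentialDisc.not_extends (h : IsEssentialDisc A φ G) {D : ℂ → X}
    (hD : ContinuousOn D (Metric.closedBall 0 1)) (hDA : ∀ ζ, ‖ζ‖ ≤ 1 → D ζ ∈ A)
    (hDG : ∀ ζ, ‖ζ‖ = 1 → D ζ = G ζ) : False := by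
  refine Complex.two_pi_I_ne_zero (eq_zero_of_extends h.continuousOn h.ne_zero hD hDA ?_)
  have : (fun s : I => φ (D (circlePoint s))) = fun s : I => circlePoint s := by
    funext s
    rw [hDG _ (norm_circlePoint _), h.apply _ (norm_circlePoint _)]
  rw [this]
  exact hasLogIncrement_circlePoint continuous_subtype_val rfl rfl

/-- If the base contracts to `b` relative to `b`, then the pair (total space, fiber over `b`) of a
Serre fibration has no essential disc. -/
theorem IsEssentialDisc.not_isSerreFibration {B : Type*} [TopologicalSpace B] {p : X → B} {b : B}
    (h : IsEssentialDisc (p ⁻¹' {b}) φ G) (c : C(I × B, B)) (hc0 : ∀ x, c (0, x) = x)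
    (hc1 : ∀ x, c (1, x) = b) (hcb : ∀ t, c (t, b) = b) : ¬ IsSerreFibration p := by
  rintro ⟨hp, hl⟩
  have hG := h.continuous
  let f : C(I^ Fin 2, X) := ⟨fun y => G (⟨2 * y 0 - 1, 2 * y 1 - 1⟩ : ℂ), hG.comp (by
    refine Complex.equivRealProdCLM.symm.continuous.comp (f := fun y : I^ Fin 2 =>
      ((2 * y 0 - 1, 2 * y 1 - 1) : ℝ × ℝ)) ?_
    fun_prop)⟩
  -- Lift the contraction of the base, starting from the disc. At time 1 the whole disc lies over
  -- `b`; its boundary stays over `b` throughout, because the contraction fixes `b`.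
  obtain ⟨K, hK0, hK⟩ := hl 2 f ⟨fun s => c (s.1, p (f s.2)), by fun_prop⟩ (fun y => hc0 _)
  -- Inverse of the affine parametrization of `[-1, 1]²` used in `f`, clamped to be defined on the
  -- whole plane.
  let y : ℂ → I^ Fin 2 := fun ζ => ![Set.projIcc 0 1 zero_le_one ((1 + ζ.re) / 2),
    Set.projIcc 0 1 zero_le_one ((1 + ζ.im) / 2)]
  have hy : Continuous y := by
    refine continuous_pi fun i => ?_
    fin_cases i
    · exact (continuous_projIcc (h := zero_le_one)).comp
        (by fun_prop : Continuous fun ζ : ℂ => (1 + ζ.re) / 2)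
    · exact (continuous_projIcc (h := zero_le_one)).comp
        (by fun_prop : Continuous fun ζ : ℂ => (1 + ζ.im) / 2)
  have hfy : ∀ ζ : ℂ, ‖ζ‖ ≤ 1 → f (y ζ) = G ζ := fun ζ hζ => by
    have h1 := abs_le.1 ((Complex.abs_re_le_norm ζ).trans hζ)
    have h2 := abs_le.1 ((Complex.abs_im_le_norm ζ).trans hζ)
    have e1 : (y ζ 0 : ℝ) = (1 + ζ.re) / 2 := by
      change ((Set.projIcc 0 1 zero_le_one _ : I) : ℝ) = _
      rw [Set.projIcc_of_mem zero_le_one ⟨by linarith, by linarith⟩]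
    have e2 : (y ζ 1 : ℝ) = (1 + ζ.im) / 2 := by
      change ((Set.projIcc 0 1 zero_le_one _ : I) : ℝ) = _
      rw [Set.projIcc_of_mem zero_le_one ⟨by linarith, by linarith⟩]
    change G _ = _
    congr 1
    apply Complex.ext
    · change 2 * (y ζ 0 : ℝ) - 1 = _
      rw [e1]; ring
    · change 2 * (y ζ 1 : ℝ) - 1 = _
      rw [e2]; ring
  have hA1 : ∀ (t : I) (s : ℝ), K (t, y (circlePoint s)) ∈ p ⁻¹' {b} := fun t s => by
    have hm : p (G (circlePoint s)) = b := h.mem _ (norm_circlePoint s).ge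
    have := hK (t, y (circlePoint s))
    rw [Set.mem_preimage, Set.mem_singleton_iff, this]
    simp only [ContinuousMap.coe_mk]
    rw [hfy _ (norm_circlePoint s).le, hm, hcb]
  refine Complex.two_pi_I_ne_zero (eq_zero_of_extends h.continuousOn h.ne_zero
    (D := fun ζ => K (1, y ζ)) (by fun_prop) (fun ζ _ => ?_) ?_)
  · rw [Set.mem_preimage, Set.mem_singleton_iff, hK]
    exact hc1 _
  · refine HasLogIncrement.of_homotopy
      (h := fun x => φ (K (x.1, y (circlePoint x.2)))) ?_ (fun x => h.ne_zero _ (hA1 _ _))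
      (fun t => ?_) ?_
    · exact h.continuousOn.comp_continuous (by fun_prop) fun x => hA1 _ _
    · simp [circlePoint_zero, circlePoint_one]
    · have : (fun s : I => φ (K (0, y (circlePoint s)))) = fun s : I => circlePoint s := by
        funext s
        rw [hK0, hfy _ (norm_circlePoint _).le, h.apply _ (norm_circlePoint _)]
      simp only [this]
      exact hasLogIncrement_circlePoint continuous_subtype_val rfl rfl

/-- Essential discs over arbitrarily small neighbourhoods of `b` make the fiber over `b`
atypical. -/
theorem isAtypicalFiber_of_essentialDisc {E B : Type} [TopologicalSpace E] [TopologicalSpace B]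
    {p : E → B} {b : B} {φ : E → ℂ}
    (h : ∀ W ∈ 𝓝 b, ∃ G, IsEssentialDisc (p ⁻¹' {b}) φ G ∧ ∀ ζ, p (G ζ) ∈ W) :
    IsAtypicalFiber p b := by
  rintro ⟨U, hU, hbU, hloc⟩
  obtain ⟨Fib, _, e, hbe⟩ := hloc ⟨b, hbU⟩
  have hW : Subtype.val '' e.baseSet ∈ 𝓝 b :=
    (hU.isOpenMap_subtype_val _ e.open_baseSet).mem_nhds ⟨_, hbe, rfl⟩
  obtain ⟨G, hG, hGW⟩ := h _ hW
  have hGU : ∀ ζ, p (G ζ) ∈ U := fun ζ => by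
    obtain ⟨x, -, hx⟩ := hGW ζ
    rw [← hx]; exact x.2
  let G' : ℂ → p ⁻¹' U := fun ζ => ⟨G ζ, hGU ζ⟩
  have hG' : Continuous G' := hG.continuous.subtype_mk _
  have hsrc : ∀ ζ, G' ζ ∈ e.source := fun ζ => by
    rw [e.mem_source]
    obtain ⟨x, hx, hx'⟩ := hGW ζ
    convert hx
    exact Subtype.ext hx'.symm
  have htgt : ∀ y : Fib, ((⟨b, hbU⟩ : U), y) ∈ e.target := fun y => by
    rw [e.mem_target]; exact hbe
  -- The trivialization projects the disc onto the fiber over `b`; boundary points already lie there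
  -- and do not move.
  let D : ℂ → p ⁻¹' U := fun ζ => e.invFun (⟨b, hbU⟩, (e (G' ζ)).2)
  have hD : Continuous D := by
    refine e.continuousOn_invFun.comp_continuous ?_ fun ζ => htgt _
    exact continuous_const.prodMk
      (continuous_snd.comp (e.continuousOn_toFun.comp_continuous hG' hsrc))
  refine hG.not_extends (D := fun ζ => (D ζ : E)) (by fun_prop) (fun ζ _ => ?_) fun ζ hζ => ?_
  · have := e.proj_symm_apply (htgt (e (G' ζ)).2)
    exact congrArg Subtype.val this
  · have hp : U.restrictPreimage p (G' ζ) = ⟨b, hbU⟩ := Subtype.ext (hG.mem ζ hζ.ge)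
    have : D ζ = G' ζ := by
      have h1 : e (G' ζ) = (⟨b, hbU⟩, (e (G' ζ)).2) := Prod.ext ((e.coe_fst (hsrc ζ)).trans hp) rfl
      change e.invFun (⟨b, hbU⟩, (e (G' ζ)).2) = _
      rw [← h1]
      exact e.left_inv (hsrc ζ)
    rw [this]

/-! ### Non-triviality of the relative homotopy set at any base point. -/

/-- Clamping a real number to the unit interval. -/
def clampUnit (x : ℝ) : ℝ := max 0 (min 1 x)

@[fun_prop]
theorem continuous_clampUnit : Continuous clampUnit := by
  unfold clampUnit; fun_prop

theorem clampUnit_of_le {x : ℝ} (h : x ≤ 0) : clampUnit x = 0 :=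
  max_eq_left ((min_le_right _ _).trans h)

theorem clampUnit_of_ge {x : ℝ} (h : 1 ≤ x) : clampUnit x = 1 := by
  simp [clampUnit, min_eq_left h]

/-- A map of the square onto the disc that collapses three sides to the point `1` and wraps the side
`b = 0` around the circle; extended to the plane by clamping. -/
noncomputable def squareToDisc (a b : ℝ) : ℂ :=
  (1 - clampUnit b : ℂ) * circlePoint (clampUnit a) + clampUnit b

/-- The parameter of the collar used to change base points. -/
def collarParam (s t : ℝ) : ℝ := min (min (4 * s) (4 - 4 * s)) (2 - 2 * t)

theorem squareToDisc_collar {s t : ℝ} (h : collarParam s t = 1) :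
    squareToDisc (2 * s - 1 / 2) (2 * t) = 1 := by
  unfold collarParam at h
  rcases min_choice (min (4 * s) (4 - 4 * s)) (2 - 2 * t) with h1 | h1
  · rw [h1] at h
    rcases min_choice (4 * s) (4 - 4 * s) with h2 | h2
    · rw [h2] at h
      rw [squareToDisc, clampUnit_of_le (x := 2 * s - 1 / 2) (by linarith), circlePoint_zero]; ring
    · rw [h2] at h
      rw [squareToDisc, clampUnit_of_ge (x := 2 * s - 1 / 2) (by linarith), circlePoint_one]; ring
  · rw [h1] at h
    rw [squareToDisc, clampUnit_of_ge (x := 2 * t) (by linarith)]; simp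

open Classical in
/-- The disc `G` on an inner rectangle, and the path `β` from parameter `max r τ` on in the collar. -/
noncomputable def collaredDisc (G : ℂ → X) (β : ℝ → X) (x : ℝ × ℝ × ℝ) : X :=
  if 1 ≤ collarParam x.2.1 x.2.2 then G (squareToDisc (2 * x.2.1 - 1 / 2) (2 * x.2.2))
  else β (max x.1 (collarParam x.2.1 x.2.2))

theorem continuous_collaredDisc {β : ℝ → X} (hG : Continuous G) (hβ : Continuous β)
    (h1 : ∀ r, 1 ≤ r → β r = G 1) : Continuous (collaredDisc G β) := by
  unfold collaredDisc
  refine Continuous.if_le ?_ ?_ continuous_const (by unfold collarParam; fun_prop) ?_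
  · unfold squareToDisc; fun_prop
  · unfold collarParam; fun_prop
  · intro x hx
    rw [squareToDisc_collar hx.symm, ← hx, h1 _ (le_max_right _ _)]

theorem collaredDisc_of_le {Y : Type*} {G : ℂ → Y} {β : ℝ → Y} {r s t : ℝ} (h : collarParam s t ≤ 0) :
    collaredDisc G β (r, s, t) = β (max r (collarParam s t)) :=
  if_neg (by simp only; linarith)

theorem IsEssentialDisc.collaredDisc_mem (h : IsEssentialDisc A φ G) {β : ℝ → X}
    (hβ : ∀ r, β r ∈ A) (r s : ℝ) : collaredDisc G β (r, s, 0) ∈ A := by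
  unfold collaredDisc
  split_ifs
  · refine h.mem _ (ge_of_eq ?_)
    simp [squareToDisc, clampUnit_of_le, norm_circlePoint]
  · exact hβ _

/-- The boundary of a relative 2-cube is a loop in `A`, and a homotopy of triples moves this loop
inside `A`. The disc, joined to the base point by a collar along a path in `A`, has boundary
increment `2πi`, whereas the constant map has increment `0`. -/
theorem IsEssentialDisc.nontrivial_relPi2 (h : IsEssentialDisc A φ G) (hA : IsPathConnected A)
    (x₀ : A) : Nontrivial (RelPi2 A x₀) := by
  obtain ⟨γ, hγ⟩ := hA.joinedIn x₀ x₀.2 (G 1) (h.mem 1 (by simp))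
  have hβ0 : ∀ r, r ≤ 0 → γ.extend r = x₀ := fun r hr => γ.extend_of_le_zero hr
  have hβ1 : ∀ r, 1 ≤ r → γ.extend r = G 1 := fun r hr => γ.extend_of_one_le hr
  have hβ : ∀ r, γ.extend r ∈ A := fun r => hγ _
  have hcont := continuous_collaredDisc h.continuous γ.continuous_extend hβ1
  have hmem := h.collaredDisc_mem hβ
  have hcol : ∀ y ∈ Cube.outerFaces (Fin.last 1), collarParam (y 0) (y 1) ≤ 0 := fun y hy => by
    unfold collarParam
    rcases hy with hy | ⟨i, hi, hy⟩
    · replace hy : y 1 = 1 := hy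
      refine (min_le_right _ _).trans ?_
      simp [hy]
    · obtain rfl : i = 0 := by
        fin_cases i
        · rfl
        · exact absurd rfl hi
      refine (min_le_left _ _).trans ?_
      rcases hy with hy | hy
      · exact (min_le_left _ _).trans (by simp [hy])
      · exact (min_le_right _ _).trans (by simp [hy])
  -- At `r = 0` the collar runs through the whole path, so the three outer faces go to `x₀`.
  let g : C(I^ Fin 2, X) := ⟨fun y => collaredDisc G γ.extend (0, y 0, y 1), by fun_prop⟩
  have hgJ : ∀ y ∈ Cube.outerFaces (Fin.last 1), g y = x₀ := fun y hy =>
    (collaredDisc_of_le (hcol y hy)).trans (hβ0 _ (max_le le_rfl (hcol y hy)))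
  have hg : g ∈ RelGenLoop (Fin.last 1) A x₀ := by
    refine ⟨fun y hy => ?_, hgJ⟩
    by_cases hy0 : y 1 = 0
    · change collaredDisc G γ.extend (0, y 0, y 1) ∈ A
      rw [hy0]; exact hmem 0 _
    · rw [hgJ y ?_]
      · exact x₀.2
      · obtain ⟨i, hi⟩ := hy
        fin_cases i
        · exact Or.inr ⟨0, by decide, hi⟩
        · exact Or.inl (hi.resolve_left hy0)
  have hk : ContinuousMap.const (I^ Fin 2) (x₀ : X) ∈ RelGenLoop (Fin.last 1) A x₀ :=
    ⟨fun _ _ => x₀.2, fun _ _ => rfl⟩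
  refine ⟨Quotient.mk _ ⟨g, hg⟩, Quotient.mk _ ⟨_, hk⟩, fun heq => ?_⟩
  obtain ⟨H⟩ : ContinuousMap.HomotopicWith g (ContinuousMap.const (I^ Fin 2) (x₀ : X))
    (fun h => h ∈ RelGenLoop (Fin.last 1) A x₀) := Quotient.exact heq
  have hH : ∀ (t : I), (∀ y ∈ Cube.boundary (Fin 2), H (t, y) ∈ A) ∧
      ∀ y ∈ Cube.outerFaces (Fin.last 1), H (t, y) = x₀ := fun t => H.prop t
  have hbd : ∀ s : I, ![s, 0] ∈ Cube.boundary (Fin 2) := fun s => ⟨1, Or.inl rfl⟩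
  have hcs : Continuous fun x : I × I => (x.1, (![x.2, 0] : I^ Fin 2)) := by
    refine continuous_fst.prodMk (continuous_pi fun i => ?_)
    fin_cases i
    · exact continuous_snd
    · exact continuous_const
  -- At `r = 1` the collar is constant at `G 1`, and the bottom edge is the unit circle traversed
  -- once, with pauses at both ends.
  have e1 : HasLogIncrement (fun s : I => φ (collaredDisc G γ.extend (1, s, 0)))
      (2 * Real.pi * Complex.I) := by
    have : (fun s : I => φ (collaredDisc G γ.extend (1, s, 0))) =
        fun s : I => circlePoint (clampUnit (2 * s - 1 / 2)) := by
      funext s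
      have hs : collaredDisc G γ.extend (1, s, 0) =
          G (circlePoint (clampUnit (2 * s - 1 / 2))) := by
        unfold collaredDisc
        split_ifs with hτ
        · simp [squareToDisc, clampUnit_of_le]
        · rw [hβ1 _ (le_max_left _ _)]
          simp only [collarParam, le_min_iff, not_and_or, not_le] at hτ
          rcases hτ with (hτ | hτ) | hτ
          · rw [clampUnit_of_le (by linarith), circlePoint_zero]
          · rw [clampUnit_of_ge (by linarith), circlePoint_one]
          · norm_num at hτ
      rw [hs, h.apply _ (norm_circlePoint _)]
    rw [this]
    refine hasLogIncrement_circlePoint (by fun_prop) (clampUnit_of_le (by norm_num))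
      (clampUnit_of_ge (by norm_num))
  have e2 : HasLogIncrement (fun s : I => φ (collaredDisc G γ.extend (0, s, 0)))
      (2 * Real.pi * Complex.I) := by
    -- Letting `r` decrease from 1 to 0 drags the base point of the loop along the path, a free
    -- homotopy in `A`.
    have := HasLogIncrement.of_homotopy
      (h := fun x : I × I => φ (collaredDisc G γ.extend (1 - x.1, x.2, 0)))
      (c := 2 * Real.pi * Complex.I)
      (h.continuousOn.comp_continuous (by fun_prop) fun x => hmem _ _)
      (fun x => h.ne_zero _ (hmem _ _)) (fun t => ?_) (by simpa using e1)
    · simpa using this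
    · have c0 : collarParam (0 : ℝ) 0 = 0 := by norm_num [collarParam]
      have c1 : collarParam (1 : ℝ) 0 = 0 := by norm_num [collarParam]
      simp only [Set.Icc.coe_zero, Set.Icc.coe_one]
      rw [collaredDisc_of_le c0.le, collaredDisc_of_le c1.le, c0, c1]
  refine Complex.two_pi_I_ne_zero ((HasLogIncrement.of_homotopy
    (h := fun x : I × I => φ (H (x.1, ![x.2, 0])))
    (h.continuousOn.comp_continuous (H.continuous.comp hcs) fun x => (hH _).1 _ (hbd _))
    (fun x => h.ne_zero _ ((hH _).1 _ (hbd _))) (fun t => ?_) ?_).eq_zero_of_const fun s => ?_)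
  · rw [(hH t).2 _ (Or.inr ⟨0, by decide, Or.inl rfl⟩), (hH t).2 _ (Or.inr ⟨0, by decide, Or.inr rfl⟩)]
  · have : ∀ s : I, H (0, ![s, 0]) = collaredDisc G γ.extend (0, s, 0) := fun s => H.apply_zero _
    simpa only [this] using e2
  · have : ∀ s : I, H (1, ![s, 0]) = x₀ := fun s => H.apply_one _
    simp only [this]
end

/-! ### Equations of the fibers over the arc. -/

theorem exampleMap_eq_iff (w : Fin 5 → ℝ) (c : ℝ) :
    exampleMap w = ![0, 0, c] ↔ w 3 = c ∧
      w 4 = (w 2 ^ 2 + c ^ 2) / ((1 + c ^ 2) * (1 + w 2 ^ 2)) ∧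
      w 1 ^ 2 = (1 + c ^ 2 * w 0) * (1 - w 4 * w 0) * (w 0 ^ 2 + (w 4 - c ^ 2) * w 0 + 1) := by
  have hpos : 0 < (1 + c ^ 2) * (1 + w 2 ^ 2) := by positivity
  rw [funext_iff, Fin.forall_fin_succ, Fin.forall_fin_two, eq_div_iff hpos.ne']
  simp only [exampleMap, Matrix.cons_val_zero, Matrix.cons_val_succ]
  constructor
  · rintro ⟨h1, h2, h3⟩
    simp only [Matrix.cons_val_one, Matrix.cons_val_zero] at h1 h2 h3
    rw [h3] at h1 h2
    refine ⟨h3, by linear_combination -h2, by linear_combination h1⟩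
  · rintro ⟨h3, h2, h1⟩
    simp only [Matrix.cons_val_one, Matrix.cons_val_zero]
    rw [h3]
    refine ⟨by linear_combination h1, by linear_combination -h2, rfl⟩

/-- The discriminant `(v - a)² - 4` is negative, since `|v - a| ≤ 1`. -/
theorem quadratic_pos {x v a : ℝ} (hv0 : 0 ≤ v) (hv1 : v ≤ 1) (ha0 : 0 ≤ a) (ha1 : a ≤ 1) :
    0 < x ^ 2 + (v - a) * x + 1 := by
  have : (v - a) ^ 2 ≤ 1 := by rw [sq_le_one_iff_abs_le_one, abs_le]; constructor <;> linarith
  nlinarith [sq_nonneg (x + (v - a) / 2)]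

theorem slope_nonneg (z c : ℝ) : 0 ≤ (z ^ 2 + c ^ 2) / ((1 + c ^ 2) * (1 + z ^ 2)) := by positivity

theorem slope_le_one (z c : ℝ) : (z ^ 2 + c ^ 2) / ((1 + c ^ 2) * (1 + z ^ 2)) ≤ 1 := by
  rw [div_le_one (by positivity)]
  nlinarith [mul_nonneg (sq_nonneg z) (sq_nonneg c)]

theorem quadratic_pos_of_slope {x v z c : ℝ} (hc0 : 0 ≤ c) (hc1 : c ≤ 1)
    (hv : v = (z ^ 2 + c ^ 2) / ((1 + c ^ 2) * (1 + z ^ 2))) :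
    0 < x ^ 2 + (v - c ^ 2) * x + 1 :=
  quadratic_pos (hv ▸ slope_nonneg z c) (hv ▸ slope_le_one z c) (sq_nonneg c)
    (pow_le_one₀ hc0 hc1)

/-! ### The explicit disc and the function that detects its boundary. -/

noncomputable section

/-- The denominator of the radial parametrization of the conic `w² = (1 + a x)(1 - v x)`. -/
def conicDenom (a v c s : ℝ) : ℝ := (v - a) * c + √((a + v) ^ 2 * c ^ 2 + 4 * s ^ 2)

/-- Since `(a + v)² = (v - a)² + 4av`, the root exceeds `|(v - a)c|` when `s ≠ 0`. When `s = 0` the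
value is `2vc`, which corresponds to the vertex `x = 1/v`. -/
theorem conicDenom_pos {a v c s : ℝ} (ha : 0 ≤ a) (hv : 0 ≤ v)
    (h : s = 0 → 0 < c ∧ 0 < v) : 0 < conicDenom a v c s := by
  by_cases hs : s = 0
  · obtain ⟨hc', hv'⟩ := h hs
    have : √((a + v) ^ 2 * c ^ 2 + 4 * s ^ 2) = (a + v) * c := by
      rw [hs, show (a + v) ^ 2 * c ^ 2 + 4 * 0 ^ 2 = ((a + v) * c) ^ 2 by ring,
        Real.sqrt_sq (by positivity)]
    rw [conicDenom, this]
    nlinarith [mul_pos hv' hc']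
  · have : |(v - a) * c| < √((a + v) ^ 2 * c ^ 2 + 4 * s ^ 2) := by
      refine Real.lt_sqrt_of_sq_lt ?_
      rw [sq_abs]
      have : 0 < s ^ 2 := by positivity
      nlinarith [mul_nonneg (mul_nonneg ha hv) (sq_nonneg c)]
    rw [conicDenom]
    linarith [neg_abs_le ((v - a) * c)]

/-- The point `(x, w) = (2/d)(c, s)` of the ray through `(c, s)` lies on the conic exactly when `d²
- 2(v - a)cd = 4s² + 4avc²`, and `conicDenom` is a root of this quadratic. -/
theorem conic_radial {a v c s : ℝ} (h : conicDenom a v c s ≠ 0) :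
    (2 / conicDenom a v c s * s) ^ 2 =
      (1 + a * (2 / conicDenom a v c s * c)) * (1 - v * (2 / conicDenom a v c s * c)) := by
  set d := conicDenom a v c s with hd
  by_cases hr : 0 ≤ (a + v) ^ 2 * c ^ 2 + 4 * s ^ 2
  · have hq : (d - (v - a) * c) ^ 2 = (a + v) ^ 2 * c ^ 2 + 4 * s ^ 2 := by
      rw [hd, conicDenom, add_sub_cancel_left, Real.sq_sqrt hr]
    field_simp
    linear_combination -hq
  · exact absurd (by positivity) hr

/-- The parameter `u` along the disc of size `ε`. -/
def discHeight (ε : ℝ) (ζ : ℂ) : ℝ := ε * max 0 (1 - ζ.re ^ 2 - ζ.im ^ 2)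

/-- The parameter `v` along the disc of size `ε`. -/
def discSlope (ε : ℝ) (ζ : ℂ) : ℝ :=
  (ζ.im ^ 2 + discHeight ε ζ ^ 2) / ((1 + discHeight ε ζ ^ 2) * (1 + ζ.im ^ 2))

/-- The denominator of the radial parametrization along the disc of size `ε`. -/
def discDenom (ε : ℝ) (ζ : ℂ) : ℝ :=
  conicDenom (discHeight ε ζ ^ 2) (discSlope ε ζ) (max 0 (1 - ζ.re ^ 2)) ζ.re

/-- The coordinate `x` along the disc of size `ε`. -/
def discAbscissa (ε : ℝ) (ζ : ℂ) : ℝ := 2 / discDenom ε ζ * max 0 (1 - ζ.re ^ 2)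

/-- The disc in the total space over the arc, with boundary in the zero fiber. -/
def exampleDisc (ε : ℝ) (ζ : ℂ) : Fin 5 → ℝ :=
  ![discAbscissa ε ζ,
    2 / discDenom ε ζ * ζ.re * √(discAbscissa ε ζ ^ 2 +
      (discSlope ε ζ - discHeight ε ζ ^ 2) * discAbscissa ε ζ + 1),
    ζ.im, discHeight ε ζ, discSlope ε ζ]

/-- A nowhere vanishing function on the zero fiber that detects the boundary of the disc. -/
def exampleDetector (w : Fin 5 → ℝ) : ℂ :=
  ⟨(w 4 * w 2 ^ 2 + √(w 4 ^ 2 * w 2 ^ 4 + 4 * max 0 (1 - w 2 ^ 2))) / 2 *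
    (w 1 / √(w 0 ^ 2 + w 4 * w 0 + 1)), w 2⟩

theorem discHeight_mem {ε : ℝ} (hε : 0 < ε) (ζ : ℂ) : discHeight ε ζ ∈ Set.Icc 0 ε := by
  refine ⟨mul_nonneg hε.le (le_max_left _ _), mul_le_of_le_one_right hε.le (max_le zero_le_one ?_)⟩
  nlinarith [sq_nonneg ζ.re, sq_nonneg ζ.im]

theorem sq_norm_eq (ζ : ℂ) : ‖ζ‖ ^ 2 = ζ.re ^ 2 + ζ.im ^ 2 := by
  rw [Complex.sq_norm, Complex.normSq_apply]; ring

theorem discHeight_eq_zero (ε : ℝ) {ζ : ℂ} (h : 1 ≤ ‖ζ‖) : discHeight ε ζ = 0 := by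
  have := sq_norm_eq ζ
  rw [discHeight, max_eq_left (by nlinarith), mul_zero]

theorem discDenom_pos {ε : ℝ} (hε : 0 < ε) (ζ : ℂ) : 0 < discDenom ε ζ := by
  refine conicDenom_pos (sq_nonneg _) (slope_nonneg _ _) fun h => ?_
  refine ⟨by simp [h], div_pos ?_ (by positivity)⟩
  -- On the axis `ζ.re = 0` positivity of `v` is needed: it comes from `z ≠ 0`, or at the center
  -- from `u = ε > 0`. This is where lifting the disc off the zero fiber matters.
  by_cases hz : ζ.im = 0
  · have : discHeight ε ζ = ε := by simp [discHeight, h, hz]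
    rw [this]; positivity
  · positivity

theorem exampleMap_exampleDisc {ε : ℝ} (hε : 0 < ε) (hε1 : ε ≤ 1) (ζ : ℂ) :
    exampleMap (exampleDisc ε ζ) = ![0, 0, discHeight ε ζ] := by
  have hu := discHeight_mem hε ζ
  rw [exampleMap_eq_iff]
  refine ⟨rfl, rfl, ?_⟩
  change (2 / discDenom ε ζ * ζ.re * √(discAbscissa ε ζ ^ 2 +
      (discSlope ε ζ - discHeight ε ζ ^ 2) * discAbscissa ε ζ + 1)) ^ 2 =
    (1 + discHeight ε ζ ^ 2 * discAbscissa ε ζ) * (1 - discSlope ε ζ * discAbscissa ε ζ) *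
    (discAbscissa ε ζ ^ 2 + (discSlope ε ζ - discHeight ε ζ ^ 2) * discAbscissa ε ζ + 1)
  have hQ : 0 < discAbscissa ε ζ ^ 2 +
      (discSlope ε ζ - discHeight ε ζ ^ 2) * discAbscissa ε ζ + 1 :=
    quadratic_pos_of_slope hu.1 (hu.2.trans hε1) rfl
  rw [mul_pow, Real.sq_sqrt hQ.le]
  congr 1
  exact conic_radial (discDenom_pos hε ζ).ne'

theorem continuous_exampleDisc {ε : ℝ} (hε : 0 < ε) : Continuous (exampleDisc ε) := by
  have hu : Continuous (discHeight ε) := by unfold discHeight; fun_prop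
  have hv : Continuous (discSlope ε) := by
    unfold discSlope
    refine Continuous.div (by fun_prop) (by fun_prop) fun ζ => by positivity
  have hd : Continuous (discDenom ε) := by unfold discDenom conicDenom; fun_prop
  have hx : Continuous (discAbscissa ε) := by
    unfold discAbscissa
    exact (continuous_const.div hd fun ζ => (discDenom_pos hε ζ).ne').mul (by fun_prop)
  have hw : Continuous fun ζ => 2 / discDenom ε ζ :=
    continuous_const.div hd fun ζ => (discDenom_pos hε ζ).ne'
  refine continuous_pi fun i => ?_
  fin_cases i
  · exact hx
  · exact (hw.mul Complex.continuous_re).mul (by fun_prop)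
  · exact Complex.continuous_im
  · exact hu
  · exact hv

theorem exampleDetector_exampleDisc {ε : ℝ} (hε : 0 < ε) {ζ : ℂ} (h : ‖ζ‖ = 1) :
    exampleDetector (exampleDisc ε ζ) = ζ := by
  have hu : discHeight ε ζ = 0 := discHeight_eq_zero ε h.ge
  have hd := discDenom_pos hε ζ
  have hn : ζ.re ^ 2 + ζ.im ^ 2 = 1 := by rw [← sq_norm_eq, h, one_pow]
  have hQ : 0 < discAbscissa ε ζ ^ 2 + discSlope ε ζ * discAbscissa ε ζ + 1 := by
    simpa [hu] using quadratic_pos_of_slope (x := discAbscissa ε ζ) (v := discSlope ε ζ)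
      (c := discHeight ε ζ) (by rw [hu]) (by rw [hu]; exact zero_le_one) rfl
  -- On the unit circle `1 - s² = z²`, so the factor in the detector is the denominator of the disc
  -- and turns `w = 2s/d` back into `s`.
  have hR : discSlope ε ζ * ζ.im ^ 2 + √(discSlope ε ζ ^ 2 * ζ.im ^ 4 +
      4 * max 0 (1 - ζ.im ^ 2)) = discDenom ε ζ := by
    rw [discDenom, conicDenom, hu, max_eq_right (by nlinarith), max_eq_right (by nlinarith),
      show 1 - ζ.re ^ 2 = ζ.im ^ 2 by linarith, show 1 - ζ.im ^ 2 = ζ.re ^ 2 by linarith]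
    ring_nf
  apply Complex.ext
  · change (discSlope ε ζ * ζ.im ^ 2 + √(discSlope ε ζ ^ 2 * ζ.im ^ 4 +
      4 * max 0 (1 - ζ.im ^ 2))) / 2 * (2 / discDenom ε ζ * ζ.re * √(discAbscissa ε ζ ^ 2 +
      (discSlope ε ζ - discHeight ε ζ ^ 2) * discAbscissa ε ζ + 1) /
      √(discAbscissa ε ζ ^ 2 + discSlope ε ζ * discAbscissa ε ζ + 1)) = ζ.re
    rw [hR, hu, zero_pow two_ne_zero, sub_zero]
    rw [mul_div_cancel_right₀ _ (Real.sqrt_pos.2 hQ).ne']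
    field_simp
  · rfl

theorem zero_eq_vec : (0 : Fin 3 → ℝ) = ![0, 0, 0] := by ext i; fin_cases i <;> rfl

theorem zero_fiber_quadratic_pos {w : Fin 5 → ℝ} (hw : exampleMap w = 0) :
    0 < w 0 ^ 2 + w 4 * w 0 + 1 := by
  rw [zero_eq_vec, exampleMap_eq_iff] at hw
  simpa using quadratic_pos_of_slope (x := w 0) le_rfl zero_le_one hw.2.1

theorem continuousOn_exampleDetector : ContinuousOn exampleDetector (exampleMap ⁻¹' {0}) := by
  have h : ContinuousOn (fun w : Fin 5 → ℝ =>
      ((w 4 * w 2 ^ 2 + √(w 4 ^ 2 * w 2 ^ 4 + 4 * max 0 (1 - w 2 ^ 2))) / 2 *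
        (w 1 / √(w 0 ^ 2 + w 4 * w 0 + 1)), w 2)) (exampleMap ⁻¹' {0}) := by
    refine ContinuousOn.prodMk (ContinuousOn.mul (by fun_prop) ?_) (by fun_prop)
    exact ContinuousOn.div (by fun_prop) (by fun_prop) fun w hw =>
      (Real.sqrt_pos.2 (zero_fiber_quadratic_pos hw)).ne'
  exact Complex.equivRealProdCLM.symm.continuous.comp_continuousOn h

/-- If `z = 0` then `v = 0`, hence `w² = 1` on the zero fiber, while the factor multiplying `w`
equals 1. -/
theorem exampleDetector_ne_zero {w : Fin 5 → ℝ} (hw : exampleMap w = 0) :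
    exampleDetector w ≠ 0 := by
  intro h
  have him : w 2 = 0 := congrArg Complex.im h
  have hre : (w 4 * w 2 ^ 2 + √(w 4 ^ 2 * w 2 ^ 4 + 4 * max 0 (1 - w 2 ^ 2))) / 2 *
    (w 1 / √(w 0 ^ 2 + w 4 * w 0 + 1)) = 0 := congrArg Complex.re h
  have hQ := (Real.sqrt_pos.2 (zero_fiber_quadratic_pos hw)).ne'
  rw [zero_eq_vec, exampleMap_eq_iff] at hw
  obtain ⟨-, h4, h1⟩ := hw
  have h4' : w 4 = 0 := by simpa [him] using h4
  rw [h4'] at hQ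
  have hy : w 1 = 0 := by
    rw [him, h4'] at hre
    simp only [div_eq_zero_iff, mul_eq_zero, hQ, or_false] at hre
    refine hre.resolve_left ?_
    norm_num
  rw [h4', hy] at h1
  nlinarith [sq_nonneg (w 0)]
end

/-! ### Smooth maps between subsets. -/

section
variable {E E' : Type*} [NormedAddCommGroup E] [NormedSpace ℝ E]
  [NormedAddCommGroup E'] [NormedSpace ℝ E']

theorem ContDiffOn.smoothOnSubset {f : E → E'} {U X : Set E} (h : ContDiffOn ℝ ∞ f U)
    (hU : IsOpen U) (hX : X ⊆ U) : SmoothOnSubset f X :=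
  fun _ hx => ⟨U, hU, hX hx, f, h, fun _ _ => rfl⟩

theorem SmoothOnSubset.continuousOn {f : E → E'} {X : Set E} (h : SmoothOnSubset f X) :
    ContinuousOn f X := fun x hx => by
  obtain ⟨U, hU, hxU, g, hg, hgf⟩ := h x hx
  have h1 : ContinuousWithinAt g (U ∩ X) x :=
    ((hg.continuousOn x hxU).mono Set.inter_subset_left)
  have h2 : ContinuousWithinAt f (U ∩ X) x := h1.congr (fun y hy => (hgf hy).symm) (hgf ⟨hxU, hx⟩).symm
  rwa [Set.inter_comm, continuousWithinAt_inter (hU.mem_nhds hxU)] at h2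

theorem DiffeomorphicSubsets.nonempty_homeomorph {X : Set E} {Y : Set E'}
    (h : DiffeomorphicSubsets X Y) : Nonempty (X ≃ₜ Y) := by
  obtain ⟨f, g, hf, hg, hinv, hfs, hgs⟩ := h
  exact ⟨{
    toFun := hf.restrict
    invFun := hg.restrict
    left_inv := fun x => Subtype.ext (hinv.1 x.2)
    right_inv := fun y => Subtype.ext (hinv.2 y.2)
    continuous_toFun := hfs.continuousOn.mapsToRestrict hf
    continuous_invFun := hgs.continuousOn.mapsToRestrict hg }⟩

theorem ContDiffOn.complexMk {f g : E → ℝ} {U : Set E} (hf : ContDiffOn ℝ ∞ f U)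
    (hg : ContDiffOn ℝ ∞ g U) : ContDiffOn ℝ ∞ (fun x => (⟨f x, g x⟩ : ℂ)) U :=
  Complex.equivRealProdCLM.symm.contDiff.comp_contDiffOn (hf.prodMk hg)

end

theorem mem_cylinder {p : ℂ × ℝ} : p ∈ cylinder ↔ p.1.re ^ 2 + p.1.im ^ 2 = 1 := by
  rw [← sq_norm_eq, cylinder, Set.mem_prod, mem_sphere_zero_iff_norm]
  simp [pow_eq_one_iff_of_nonneg (norm_nonneg p.1)]

theorem contDiff_slope (c : ℝ) {E : Type*} [NormedAddCommGroup E] [NormedSpace ℝ E] {z : E → ℝ}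
    (hz : ContDiff ℝ ∞ z) :
    ContDiff ℝ ∞ fun x => (z x ^ 2 + c ^ 2) / ((1 + c ^ 2) * (1 + z x ^ 2)) :=
  ((hz.pow 2).add contDiff_const).div (contDiff_const.mul (contDiff_const.add (hz.pow 2)))
    fun x => by positivity

/-! ### Fibers over the points with `c > 0`. -/

noncomputable section

/-- From the fiber over `(0, 0, c)`, `c ≠ 0`, to the cylinder. -/
def fiberToCylinder (c : ℝ) (w : Fin 5 → ℝ) : ℂ × ℝ :=
  (⟨(2 * c ^ 2 * w 4 * w 0 - (c ^ 2 - w 4)) / (c ^ 2 + w 4),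
    2 * √(c ^ 2 * w 4) * (w 1 / √(w 0 ^ 2 + (w 4 - c ^ 2) * w 0 + 1)) / (c ^ 2 + w 4)⟩, w 2)

/-- The coordinate `v` on the fiber over `(0, 0, c)`. -/
def fiberSlope (c : ℝ) (p : ℂ × ℝ) : ℝ := (p.2 ^ 2 + c ^ 2) / ((1 + c ^ 2) * (1 + p.2 ^ 2))

/-- The coordinate `x` on the fiber over `(0, 0, c)`, `c ≠ 0`. -/
def fiberAbscissa (c : ℝ) (p : ℂ × ℝ) : ℝ :=
  ((c ^ 2 + fiberSlope c p) * p.1.re + c ^ 2 - fiberSlope c p) / (2 * c ^ 2 * fiberSlope c p)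

/-- From the cylinder to the fiber over `(0, 0, c)`, `c ≠ 0`. -/
def cylinderToFiber (c : ℝ) (p : ℂ × ℝ) : Fin 5 → ℝ :=
  ![fiberAbscissa c p,
    √(fiberAbscissa c p ^ 2 + (fiberSlope c p - c ^ 2) * fiberAbscissa c p + 1) *
      ((c ^ 2 + fiberSlope c p) * p.1.im / (2 * √(c ^ 2 * fiberSlope c p))),
    p.2, c, fiberSlope c p]

theorem fiberSlope_pos {c : ℝ} (hc : 0 < c) (p : ℂ × ℝ) : 0 < fiberSlope c p := by
  unfold fiberSlope; positivity

theorem smoothOnSubset_fiberToCylinder {c : ℝ} (hc : 0 < c) (hc1 : c ≤ 1) :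
    SmoothOnSubset (fiberToCylinder c) (exampleMap ⁻¹' {![0, 0, c]}) := by
  have hsub : exampleMap ⁻¹' {![0, 0, c]} ⊆
      {w | 0 < w 4} ∩ {w | 0 < w 0 ^ 2 + (w 4 - c ^ 2) * w 0 + 1} := fun w hw => by
    have hw' := (exampleMap_eq_iff w c).1 hw
    refine ⟨?_, quadratic_pos_of_slope hc.le hc1 hw'.2.1⟩
    rw [Set.mem_ofPred_eq, hw'.2.1]; positivity
  refine ContDiffOn.smoothOnSubset ?_ ((isOpen_lt (by fun_prop) (by fun_prop)).inter
    (isOpen_lt (by fun_prop) (by fun_prop))) hsub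
  refine ContDiffOn.prodMk (ContDiffOn.complexMk ?_ ?_) (by fun_prop)
  · refine ContDiffOn.div (by fun_prop) (by fun_prop) fun w hw => ?_
    have : 0 < w 4 := hw.1
    positivity
  · refine ContDiffOn.div (ContDiffOn.mul (ContDiffOn.mul (by fun_prop) (ContDiffOn.sqrt
      (by fun_prop) fun w hw => ?_)) (ContDiffOn.div (by fun_prop) (ContDiffOn.sqrt
      (by fun_prop) fun w hw => hw.2.ne') fun w hw => (Real.sqrt_pos.2 hw.2).ne')) (by fun_prop)
      fun w hw => ?_
    · have : 0 < w 4 := hw.1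
      positivity
    · have : 0 < w 4 := hw.1
      positivity

theorem smoothOnSubset_cylinderToFiber {c : ℝ} (hc : 0 < c) (hc1 : c ≤ 1) :
    SmoothOnSubset (cylinderToFiber c) cylinder := by
  refine ContDiffOn.smoothOnSubset (ContDiff.contDiffOn ?_) isOpen_univ (Set.subset_univ _)
  have hre : ContDiff ℝ ∞ fun p : ℂ × ℝ => p.1.re := Complex.reCLM.contDiff.comp contDiff_fst
  have him : ContDiff ℝ ∞ fun p : ℂ × ℝ => p.1.im := Complex.imCLM.contDiff.comp contDiff_fst
  have hv : ContDiff ℝ ∞ (fiberSlope c) := contDiff_slope c contDiff_snd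
  have hx : ContDiff ℝ ∞ (fiberAbscissa c) := by
    refine ContDiff.div (by fun_prop) (by fun_prop) fun p => ?_
    have := fiberSlope_pos hc p
    positivity
  refine contDiff_pi.2 fun i => ?_
  fin_cases i
  · exact hx
  · refine ContDiff.mul (ContDiff.sqrt (by fun_prop) fun p =>
      (quadratic_pos_of_slope hc.le hc1 rfl).ne') (ContDiff.div (by fun_prop) (ContDiff.mul
      (by fun_prop) (ContDiff.sqrt (by fun_prop) fun p => ?_)) fun p => ?_)
    · have := fiberSlope_pos hc p
      positivity
    · have := fiberSlope_pos hc p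
      positivity
  · exact contDiff_snd
  · exact contDiff_const
  · exact hv

/-- With `a = c²`, completing the square in `w² = (1 + ax)(1 - vx)` gives `(2avx - (a - v))² + 4avw²
= (a + v)²`. Dividing by `(a + v)²` yields the point of the unit circle; the height is `z`. -/
theorem diffeomorphic_fiber_of_pos {c : ℝ} (hc : 0 < c) (hc1 : c ≤ 1) :
    DiffeomorphicSubsets (exampleMap ⁻¹' {![0, 0, c]}) cylinder := by
  refine ⟨fiberToCylinder c, cylinderToFiber c, fun w hw => ?_, fun p hp => ?_,
    ⟨fun w hw => ?_, fun p hp => ?_⟩, smoothOnSubset_fiberToCylinder hc hc1,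
    smoothOnSubset_cylinderToFiber hc hc1⟩
  · obtain ⟨h3, h4, h1⟩ := (exampleMap_eq_iff w c).1 hw
    have hQ := quadratic_pos_of_slope (x := w 0) hc.le hc1 h4
    have hv : 0 < w 4 := by rw [h4]; positivity
    rw [mem_cylinder]
    simp only [fiberToCylinder]
    simp only [div_pow, mul_pow]
    rw [Real.sq_sqrt hQ.le, Real.sq_sqrt (by positivity), h1, mul_div_assoc, mul_div_cancel_right₀ _ hQ.ne']
    field_simp
    ring
  · rw [mem_cylinder] at hp
    have hv := fiberSlope_pos hc p
    have hQ : 0 < fiberAbscissa c p ^ 2 + (fiberSlope c p - c ^ 2) * fiberAbscissa c p + 1 :=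
      quadratic_pos_of_slope hc.le hc1 rfl
    refine (exampleMap_eq_iff _ c).2 ⟨rfl, rfl, ?_⟩
    change (√(fiberAbscissa c p ^ 2 + (fiberSlope c p - c ^ 2) * fiberAbscissa c p + 1) *
      ((c ^ 2 + fiberSlope c p) * p.1.im / (2 * √(c ^ 2 * fiberSlope c p)))) ^ 2 =
      (1 + c ^ 2 * fiberAbscissa c p) * (1 - fiberSlope c p * fiberAbscissa c p) *
      (fiberAbscissa c p ^ 2 + (fiberSlope c p - c ^ 2) * fiberAbscissa c p + 1)
    rw [mul_pow, Real.sq_sqrt hQ.le, mul_comm]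
    congr 1
    rw [div_pow, mul_pow 2, Real.sq_sqrt (by positivity)]
    have him : p.1.im ^ 2 = 1 - p.1.re ^ 2 := by linarith
    rw [mul_pow, him, fiberAbscissa]
    field_simp
    ring
  · obtain ⟨h3, h4, h1⟩ := (exampleMap_eq_iff w c).1 hw
    have hQ := Real.sqrt_pos.2 (quadratic_pos_of_slope (x := w 0) hc.le hc1 h4)
    have hv : 0 < w 4 := by rw [h4]; positivity
    have hs : fiberSlope c (fiberToCylinder c w) = w 4 := by rw [h4]; rfl
    have hx : fiberAbscissa c (fiberToCylinder c w) = w 0 := by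
      rw [fiberAbscissa, hs]
      simp only [fiberToCylinder]
      field_simp
      ring
    have hsq : 0 < √(c ^ 2 * w 4) := Real.sqrt_pos.2 (by positivity)
    unfold cylinderToFiber
    rw [hs, hx]
    ext i
    fin_cases i
    · rfl
    · simp only [fiberToCylinder]
      change _ = w 1
      generalize √(c ^ 2 * w 4) = q at *
      generalize √(w 0 ^ 2 + (w 4 - c ^ 2) * w 0 + 1) = Q at *
      change Q * ((c ^ 2 + w 4) * (2 * q * (w 1 / Q) / (c ^ 2 + w 4)) / (2 * q)) = w 1
      field_simp
    · rfl
    · exact h3.symm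
    · rfl
  · have hv := fiberSlope_pos hc p
    have hQ : 0 < √(fiberAbscissa c p ^ 2 + (fiberSlope c p - c ^ 2) * fiberAbscissa c p + 1) :=
      Real.sqrt_pos.2 (quadratic_pos_of_slope hc.le hc1 rfl)
    have hsq : 0 < √(c ^ 2 * fiberSlope c p) := Real.sqrt_pos.2 (by positivity)
    refine Prod.ext (Complex.ext ?_ ?_) rfl
    · change (2 * c ^ 2 * fiberSlope c p * fiberAbscissa c p - (c ^ 2 - fiberSlope c p)) /
        (c ^ 2 + fiberSlope c p) = p.1.re
      rw [fiberAbscissa]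
      field_simp
      ring
    · change 2 * √(c ^ 2 * fiberSlope c p) *
        (√(fiberAbscissa c p ^ 2 + (fiberSlope c p - c ^ 2) * fiberAbscissa c p + 1) *
        ((c ^ 2 + fiberSlope c p) * p.1.im / (2 * √(c ^ 2 * fiberSlope c p))) /
        √(fiberAbscissa c p ^ 2 + (fiberSlope c p - c ^ 2) * fiberAbscissa c p + 1)) /
        (c ^ 2 + fiberSlope c p) = p.1.im
      rw [mul_div_cancel_left₀ _ hQ.ne']
      field_simp

/-! ### The fiber over zero. -/

/-- The coordinate `y / √(x² + v x + 1)` on the zero fiber. -/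
def zeroFiberOrdinate (w : Fin 5 → ℝ) : ℝ := w 1 / √(w 0 ^ 2 + w 4 * w 0 + 1)

/-- From the zero fiber to the cylinder. -/
def zeroFiberToCylinder (w : Fin 5 → ℝ) : ℂ × ℝ :=
  (⟨zeroFiberOrdinate w / √(zeroFiberOrdinate w ^ 2 + w 2 ^ 2),
    w 2 / √(zeroFiberOrdinate w ^ 2 + w 2 ^ 2)⟩, w 0 / (1 + w 2 ^ 2) - w 2 ^ 2)

/-- The number `D = r⁻²`, where `r` is the radius `√(w² + z²)` on the zero fiber with
`w = y / √(x² + v x + 1)`. -/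
def invSqRadius (p : ℂ × ℝ) : ℝ :=
  (p.2 * p.1.im ^ 2 + 1 - p.1.im ^ 2 +
    √((p.2 * p.1.im ^ 2 + 1 - p.1.im ^ 2) ^ 2 + 4 * p.1.im ^ 4)) / 2

/-- The coordinate `z` on the zero fiber. -/
def zeroFiberHeight (p : ℂ × ℝ) : ℝ := p.1.im / √(invSqRadius p)

/-- The coordinate `x` on the zero fiber. -/
def zeroFiberAbscissa (p : ℂ × ℝ) : ℝ :=
  (p.2 + p.1.im ^ 2 / invSqRadius p) * (1 + zeroFiberHeight p ^ 2)

/-- The coordinate `v` on the zero fiber. -/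
def zeroFiberSlope (p : ℂ × ℝ) : ℝ := zeroFiberHeight p ^ 2 / (1 + zeroFiberHeight p ^ 2)

/-- From the cylinder to the zero fiber. -/
def cylinderToZeroFiber (p : ℂ × ℝ) : Fin 5 → ℝ :=
  ![zeroFiberAbscissa p,
    p.1.re / √(invSqRadius p) *
      √(zeroFiberAbscissa p ^ 2 + zeroFiberSlope p * zeroFiberAbscissa p + 1),
    zeroFiberHeight p, 0, zeroFiberSlope p]

theorem invSqRadius_disc_pos (p : ℂ × ℝ) :
    0 < (p.2 * p.1.im ^ 2 + 1 - p.1.im ^ 2) ^ 2 + 4 * p.1.im ^ 4 := by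
  by_cases h : p.1.im = 0
  · simp [h]
  · positivity

theorem invSqRadius_pos (p : ℂ × ℝ) : 0 < invSqRadius p := by
  unfold invSqRadius
  by_cases h : p.1.im = 0
  · simp [h]
  · have : |p.2 * p.1.im ^ 2 + 1 - p.1.im ^ 2| <
        √((p.2 * p.1.im ^ 2 + 1 - p.1.im ^ 2) ^ 2 + 4 * p.1.im ^ 4) := by
      refine Real.lt_sqrt_of_sq_lt ?_
      rw [sq_abs]
      have : 0 < p.1.im ^ 4 := by positivity
      linarith
    linarith [neg_abs_le (p.2 * p.1.im ^ 2 + 1 - p.1.im ^ 2)]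

/-- Put `w = r cos θ`, `z = r sin θ` and `x = (S + z²)(1 + z²)`. Then `w² = 1 - vx` becomes `D² =
(cos²θ + S sin²θ) D + sin⁴θ` for `D = r⁻²`. It has exactly one positive root for every real `S`; the
shift by `z²` in the height coordinate `S` creates the term `sin⁴θ` that ensures this. -/
theorem invSqRadius_sq (p : ℂ × ℝ) :
    invSqRadius p ^ 2 = (p.2 * p.1.im ^ 2 + 1 - p.1.im ^ 2) * invSqRadius p + p.1.im ^ 4 := by
  have := Real.sq_sqrt (invSqRadius_disc_pos p).le
  unfold invSqRadius
  linear_combination this / 4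

theorem zeroFiberSlope_mem (p : ℂ × ℝ) : 0 ≤ zeroFiberSlope p ∧ zeroFiberSlope p ≤ 1 := by
  refine ⟨by unfold zeroFiberSlope; positivity, ?_⟩
  rw [zeroFiberSlope, div_le_one (by positivity)]
  linarith

theorem zeroFiber_quadratic_pos (p : ℂ × ℝ) :
    0 < zeroFiberAbscissa p ^ 2 + zeroFiberSlope p * zeroFiberAbscissa p + 1 := by
  simpa using quadratic_pos (x := zeroFiberAbscissa p) (zeroFiberSlope_mem p).1
    (zeroFiberSlope_mem p).2 le_rfl zero_le_one

theorem zeroFiber_radius_pos {w : Fin 5 → ℝ} (hQ : 0 < w 0 ^ 2 + w 4 * w 0 + 1)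
    (h : 0 < w 1 ^ 2 + w 2 ^ 2) : 0 < zeroFiberOrdinate w ^ 2 + w 2 ^ 2 := by
  by_cases hz : w 2 = 0
  · have : w 1 ≠ 0 := by rintro h1; simp [h1, hz] at h
    have := Real.sqrt_pos.2 hQ
    unfold zeroFiberOrdinate
    positivity
  · positivity

theorem sq_add_sq_pos_of_zero_fiber {w : Fin 5 → ℝ} (hw : exampleMap w = ![0, 0, 0]) :
    0 < w 1 ^ 2 + w 2 ^ 2 := by
  obtain ⟨-, h4, h1⟩ := (exampleMap_eq_iff w 0).1 hw
  by_cases hz : w 2 = 0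
  · have h4' : w 4 = 0 := by simpa [hz] using h4
    rw [h4'] at h1
    nlinarith [sq_nonneg (w 0), sq_nonneg (w 2)]
  · positivity

theorem smoothOnSubset_zeroFiberToCylinder :
    SmoothOnSubset zeroFiberToCylinder (exampleMap ⁻¹' {![0, 0, 0]}) := by
  have hsub : exampleMap ⁻¹' {![0, 0, 0]} ⊆
      {w | 0 < w 0 ^ 2 + w 4 * w 0 + 1} ∩ {w | 0 < w 1 ^ 2 + w 2 ^ 2} := fun w hw =>
    ⟨zero_fiber_quadratic_pos (hw.trans zero_eq_vec.symm), sq_add_sq_pos_of_zero_fiber hw⟩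
  refine ContDiffOn.smoothOnSubset ?_ ((isOpen_lt (by fun_prop) (by fun_prop)).inter
    (isOpen_lt (by fun_prop) (by fun_prop))) hsub
  have hW : ContDiffOn ℝ ∞ zeroFiberOrdinate
      ({w | 0 < w 0 ^ 2 + w 4 * w 0 + 1} ∩ {w | 0 < w 1 ^ 2 + w 2 ^ 2}) :=
    ContDiffOn.div (by fun_prop) (ContDiffOn.sqrt (by fun_prop) fun w hw => hw.1.ne')
      fun w hw => (Real.sqrt_pos.2 hw.1).ne'
  have hr : ContDiffOn ℝ ∞ (fun w => √(zeroFiberOrdinate w ^ 2 + w 2 ^ 2))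
      ({w | 0 < w 0 ^ 2 + w 4 * w 0 + 1} ∩ {w | 0 < w 1 ^ 2 + w 2 ^ 2}) :=
    ContDiffOn.sqrt (by fun_prop) fun w hw => (zeroFiber_radius_pos hw.1 hw.2).ne'
  refine ContDiffOn.prodMk (ContDiffOn.complexMk ?_ ?_) ?_
  · exact hW.div hr fun w hw => (Real.sqrt_pos.2 (zeroFiber_radius_pos hw.1 hw.2)).ne'
  · exact ContDiffOn.div (by fun_prop) hr fun w hw =>
      (Real.sqrt_pos.2 (zeroFiber_radius_pos hw.1 hw.2)).ne'
  · exact ContDiffOn.sub (ContDiffOn.div (by fun_prop) (by fun_prop) fun w hw => by positivity)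
      (by fun_prop)

theorem smoothOnSubset_cylinderToZeroFiber : SmoothOnSubset cylinderToZeroFiber cylinder := by
  refine ContDiffOn.smoothOnSubset (ContDiff.contDiffOn ?_) isOpen_univ (Set.subset_univ _)
  have hre : ContDiff ℝ ∞ fun p : ℂ × ℝ => p.1.re := Complex.reCLM.contDiff.comp contDiff_fst
  have him : ContDiff ℝ ∞ fun p : ℂ × ℝ => p.1.im := Complex.imCLM.contDiff.comp contDiff_fst
  have hD : ContDiff ℝ ∞ invSqRadius :=
    (ContDiff.add (by fun_prop) (ContDiff.sqrt (by fun_prop)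
      fun p => (invSqRadius_disc_pos p).ne')).div_const 2
  have hr : ContDiff ℝ ∞ fun p => √(invSqRadius p) := hD.sqrt fun p => (invSqRadius_pos p).ne'
  have hr0 : ∀ p, √(invSqRadius p) ≠ 0 := fun p => (Real.sqrt_pos.2 (invSqRadius_pos p)).ne'
  have hz : ContDiff ℝ ∞ zeroFiberHeight := him.div hr hr0
  have hx : ContDiff ℝ ∞ zeroFiberAbscissa :=
    (contDiff_snd.add ((him.pow 2).div hD fun p => (invSqRadius_pos p).ne')).mul (by fun_prop)
  have hv : ContDiff ℝ ∞ zeroFiberSlope :=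
    ContDiff.div (by fun_prop) (by fun_prop) fun p => by positivity
  refine contDiff_pi.2 fun i => ?_
  fin_cases i
  · exact hx
  · exact (hre.div hr hr0).mul (ContDiff.sqrt (by fun_prop)
      fun p => (zeroFiber_quadratic_pos p).ne')
  · exact hz
  · exact contDiff_const
  · exact hv

theorem diffeomorphic_zero_fiber :
    DiffeomorphicSubsets (exampleMap ⁻¹' {![0, 0, 0]}) cylinder := by
  have hr0 : ∀ w ∈ exampleMap ⁻¹' {![0, 0, 0]}, 0 < zeroFiberOrdinate w ^ 2 + w 2 ^ 2 :=
    fun w hw => zeroFiber_radius_pos (zero_fiber_quadratic_pos (hw.trans zero_eq_vec.symm))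
      (sq_add_sq_pos_of_zero_fiber hw)
  have hzsq : ∀ p, zeroFiberHeight p ^ 2 = p.1.im ^ 2 / invSqRadius p := fun p => by
    rw [zeroFiberHeight, div_pow, Real.sq_sqrt (invSqRadius_pos p).le]
  refine ⟨zeroFiberToCylinder, cylinderToZeroFiber, fun w hw => ?_, fun p hp => ?_,
    ⟨fun w hw => ?_, fun p hp => ?_⟩, smoothOnSubset_zeroFiberToCylinder,
    smoothOnSubset_cylinderToZeroFiber⟩
  · rw [mem_cylinder]
    simp only [zeroFiberToCylinder, div_pow]
    rw [Real.sq_sqrt (hr0 w hw).le, ← add_div, div_self (hr0 w hw).ne']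
  · rw [mem_cylinder] at hp
    have hD := invSqRadius_pos p
    refine (exampleMap_eq_iff _ 0).2 ⟨rfl, ?_, ?_⟩
    · change zeroFiberHeight p ^ 2 / (1 + zeroFiberHeight p ^ 2) =
        (zeroFiberHeight p ^ 2 + 0 ^ 2) / ((1 + 0 ^ 2) * (1 + zeroFiberHeight p ^ 2))
      simp
    · change (p.1.re / √(invSqRadius p) *
        √(zeroFiberAbscissa p ^ 2 + zeroFiberSlope p * zeroFiberAbscissa p + 1)) ^ 2 =
        (1 + 0 ^ 2 * zeroFiberAbscissa p) * (1 - zeroFiberSlope p * zeroFiberAbscissa p) *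
        (zeroFiberAbscissa p ^ 2 + (zeroFiberSlope p - 0 ^ 2) * zeroFiberAbscissa p + 1)
      rw [mul_pow, Real.sq_sqrt (zeroFiber_quadratic_pos p).le, div_pow, Real.sq_sqrt hD.le,
        zero_pow two_ne_zero, sub_zero]
      congr 1
      have hvx : zeroFiberSlope p * zeroFiberAbscissa p =
          zeroFiberHeight p ^ 2 * (p.2 + p.1.im ^ 2 / invSqRadius p) := by
        rw [zeroFiberSlope, zeroFiberAbscissa]
        field_simp
      rw [hvx, hzsq]
      have := invSqRadius_sq p
      field_simp
      rw [show p.1.re ^ 2 = 1 - p.1.im ^ 2 by linarith]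
      linear_combination -this
  · obtain ⟨h3, h4, h1⟩ := (exampleMap_eq_iff w 0).1 hw
    have hr := hr0 w hw
    have hQ := zero_fiber_quadratic_pos (hw.trans zero_eq_vec.symm)
    have hW : zeroFiberOrdinate w ^ 2 = 1 - w 4 * w 0 := by
      rw [zeroFiberOrdinate, div_pow, Real.sq_sqrt hQ.le, h1, div_eq_iff hQ.ne']
      ring
    have h4' : w 4 = w 2 ^ 2 / (1 + w 2 ^ 2) := by rw [h4]; simp
    set W := zeroFiberOrdinate w with hWdef
    set r := √(W ^ 2 + w 2 ^ 2) with hrdef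
    have hrpos : 0 < r := Real.sqrt_pos.2 hr
    have hr2 : r ^ 2 = W ^ 2 + w 2 ^ 2 := Real.sq_sqrt hr.le
    have him : (zeroFiberToCylinder w).1.im = w 2 / r := rfl
    have hre : (zeroFiberToCylinder w).1.re = W / r := rfl
    have hS : (zeroFiberToCylinder w).2 = w 0 / (1 + w 2 ^ 2) - w 2 ^ 2 := rfl
    -- With this linear coefficient the discriminant is the perfect square `((1 + z⁴)/r²)²`, and the
    -- positive root is `1/r²`.
    have hb : (w 0 / (1 + w 2 ^ 2) - w 2 ^ 2) * (w 2 / r) ^ 2 + 1 - (w 2 / r) ^ 2 =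
        (1 - w 2 ^ 4) / r ^ 2 := by
      rw [h4'] at hW
      rw [hW] at hr2
      field_simp
      field_simp at hr2
      linear_combination hr2
    have hD : invSqRadius (zeroFiberToCylinder w) = (1 / r) ^ 2 := by
      rw [invSqRadius, him, hS, hb, show ((1 - w 2 ^ 4) / r ^ 2) ^ 2 + 4 * (w 2 / r) ^ 4 =
        ((1 + w 2 ^ 4) / r ^ 2) ^ 2 by field_simp; ring, Real.sqrt_sq (by positivity)]
      field_simp
      ring
    have hsD : √(invSqRadius (zeroFiberToCylinder w)) = 1 / r := by
      rw [hD, Real.sqrt_sq (by positivity)]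
    have hz : zeroFiberHeight (zeroFiberToCylinder w) = w 2 := by
      rw [zeroFiberHeight, hsD, him]; field_simp
    have hx : zeroFiberAbscissa (zeroFiberToCylinder w) = w 0 := by
      rw [zeroFiberAbscissa, hz, hD, him, hS]; field_simp; ring
    have hv : zeroFiberSlope (zeroFiberToCylinder w) = w 4 := by rw [zeroFiberSlope, hz, h4']
    unfold cylinderToZeroFiber
    rw [hz, hx, hv, hsD, hre]
    ext i
    fin_cases i
    · rfl
    · change W / r / (1 / r) * √(w 0 ^ 2 + w 4 * w 0 + 1) = w 1
      rw [hWdef, zeroFiberOrdinate]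
      have := Real.sqrt_pos.2 hQ
      generalize √(w 0 ^ 2 + w 4 * w 0 + 1) = Q at *
      field_simp
    · rfl
    · exact h3.symm
    · rfl
  · rw [mem_cylinder] at hp
    have hD := invSqRadius_pos p
    have hs := Real.sqrt_pos.2 hD
    have hQ := Real.sqrt_pos.2 (zeroFiber_quadratic_pos p)
    have hW : zeroFiberOrdinate (cylinderToZeroFiber p) = p.1.re / √(invSqRadius p) :=
      mul_div_cancel_right₀ _ hQ.ne'
    have hz : cylinderToZeroFiber p 2 = p.1.im / √(invSqRadius p) := rfl
    have hr : √(zeroFiberOrdinate (cylinderToZeroFiber p) ^ 2 + cylinderToZeroFiber p 2 ^ 2) =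
        1 / √(invSqRadius p) := by
      rw [hW, hz, div_pow, div_pow, ← add_div, hp, Real.sq_sqrt hD.le, Real.sqrt_div zero_le_one,
        Real.sqrt_one]
    refine Prod.ext (Complex.ext ?_ ?_) ?_
    · change zeroFiberOrdinate (cylinderToZeroFiber p) / √(zeroFiberOrdinate
        (cylinderToZeroFiber p) ^ 2 + cylinderToZeroFiber p 2 ^ 2) = p.1.re
      rw [hr, hW]
      field_simp
    · change cylinderToZeroFiber p 2 / √(zeroFiberOrdinate
        (cylinderToZeroFiber p) ^ 2 + cylinderToZeroFiber p 2 ^ 2) = p.1.im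
      rw [hr, hz]
      field_simp
    · change zeroFiberAbscissa p / (1 + zeroFiberHeight p ^ 2) - zeroFiberHeight p ^ 2 = p.2
      rw [zeroFiberAbscissa, mul_div_cancel_right₀ _ (by positivity), hzsq]
      ring

end

/-! ### Absence of singular points over the arc. -/

theorem differentiable_exampleMap : Differentiable ℝ exampleMap := by
  refine differentiable_pi.2 fun i => ?_
  fin_cases i <;> simp only [exampleMap] <;> simp <;> fun_prop

theorem hasDerivAt_exampleMap_line (w e : Fin 5 → ℝ) (i : Fin 3) :
    HasDerivAt (fun t : ℝ => exampleMap (w + t • e) i) (fderiv ℝ exampleMap w e i) 0 := by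
  have h2 : HasDerivAt (fun t : ℝ => w + t • e) e 0 := by
    simpa using ((hasDerivAt_id (0 : ℝ)).smul_const e).const_add w
  have h3 : HasFDerivAt exampleMap (fderiv ℝ exampleMap w) (w + (0 : ℝ) • e) := by
    simpa using (differentiable_exampleMap w).hasFDerivAt
  exact hasDerivAt_pi.1 (h3.comp_hasDerivAt 0 h2) i

/-- The partial derivative of the first component of `exampleMap` in the direction `x`. -/
noncomputable def exampleMapDx (w : Fin 5 → ℝ) : ℝ :=
  w 3 ^ 2 * (w 4 * w 0 - 1) * (w 0 ^ 2 + (w 4 - w 3 ^ 2) * w 0 + 1) +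
  (w 3 ^ 2 * w 0 + 1) * w 4 * (w 0 ^ 2 + (w 4 - w 3 ^ 2) * w 0 + 1) +
  (w 3 ^ 2 * w 0 + 1) * (w 4 * w 0 - 1) * (2 * w 0 + (w 4 - w 3 ^ 2))

theorem fderiv_exampleMap_x (w : Fin 5 → ℝ) :
    fderiv ℝ exampleMap w ![1, 0, 0, 0, 0] = ![exampleMapDx w, 0, 0] := by
  ext i
  refine (hasDerivAt_exampleMap_line w _ i).unique ?_
  fin_cases i <;> simp [exampleMap]
  · have hX : HasDerivAt (fun t : ℝ => w 0 + t) 1 0 := (hasDerivAt_id 0).const_add _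
    have h1 := (hX.const_mul (w 3 ^ 2)).add_const 1
    have h2 := (hX.const_mul (w 4)).sub_const 1
    have h3 := ((hX.pow 2).add (hX.const_mul (w 4 - w 3 ^ 2))).add_const 1
    refine ((h1.mul h2).mul h3).congr_deriv ?_
    simp [exampleMapDx]
    ring
  · exact hasDerivAt_const _ _
  · exact hasDerivAt_const _ _

theorem fderiv_exampleMap_y (w : Fin 5 → ℝ) :
    fderiv ℝ exampleMap w ![0, 1, 0, 0, 0] = ![2 * w 1, 0, 0] := by
  ext i
  refine (hasDerivAt_exampleMap_line w _ i).unique ?_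
  fin_cases i <;> simp [exampleMap]
  · have hX : HasDerivAt (fun t : ℝ => w 1 + t) 1 0 := (hasDerivAt_id 0).const_add _
    refine (hX.pow 2).congr_deriv ?_
    simp
  · exact hasDerivAt_const _ _
  · exact hasDerivAt_const _ _

theorem fderiv_exampleMap_v_one (w : Fin 5 → ℝ) :
    fderiv ℝ exampleMap w ![0, 0, 0, 0, 1] 1 = -((w 3 ^ 2 + 1) * (w 2 ^ 2 + 1)) := by
  refine (hasDerivAt_exampleMap_line w _ 1).unique ?_
  simp [exampleMap]
  have hX : HasDerivAt (fun t : ℝ => w 4 + t) 1 0 := (hasDerivAt_id 0).const_add _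
  refine (((hX.mul_const (w 3 ^ 2 + 1)).mul_const (w 2 ^ 2 + 1)).const_sub _).congr_deriv ?_
  ring

theorem fderiv_exampleMap_v_two (w : Fin 5 → ℝ) :
    fderiv ℝ exampleMap w ![0, 0, 0, 0, 1] 2 = 0 := by
  refine (hasDerivAt_exampleMap_line w _ 2).unique ?_
  simp [exampleMap]
  exact hasDerivAt_const _ _

theorem fderiv_exampleMap_u_two (w : Fin 5 → ℝ) :
    fderiv ℝ exampleMap w ![0, 0, 0, 1, 0] 2 = 1 := by
  refine (hasDerivAt_exampleMap_line w _ 2).unique ?_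
  simp [exampleMap]
  exact (hasDerivAt_id 0).const_add _

/-- Where `y = 0`, the coordinate `x` is a root of `(1 + c²x)(1 - vx)`. A root of the first factor
is negative and a root of the second positive, so the root is simple, and `Q` does not vanish. -/
theorem exampleMapDx_ne_zero {w : Fin 5 → ℝ} {c : ℝ} (hc : 0 ≤ c) (hc1 : c ≤ 1)
    (hw : exampleMap w = ![0, 0, c]) (hy : w 1 = 0) : exampleMapDx w ≠ 0 := by
  obtain ⟨h3, h4, h1⟩ := (exampleMap_eq_iff w c).1 hw
  have hQ := quadratic_pos_of_slope (x := w 0) hc hc1 h4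
  have hv : 0 ≤ w 4 := h4 ▸ slope_nonneg _ _
  rw [hy, eq_comm, zero_pow two_ne_zero] at h1
  rw [exampleMapDx, h3]
  generalize w 0 ^ 2 + (w 4 - c ^ 2) * w 0 + 1 = Q at *
  rcases mul_eq_zero.1 ((mul_eq_zero.1 h1).resolve_right hQ.ne') with h | h
  · have hc0 : 0 < c ^ 2 := by
      refine (sq_nonneg c).lt_of_ne' fun h0 => ?_
      simp [h0] at h
    have hx : w 0 < 0 := by nlinarith
    have h' : w 4 * w 0 - 1 < 0 := by nlinarith
    rw [show c ^ 2 * w 0 + 1 = 0 by linarith]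
    simp only [zero_mul, add_zero]
    exact mul_ne_zero (mul_ne_zero hc0.ne' h'.ne) hQ.ne'
  · have hv0 : w 4 ≠ 0 := fun h0 => by simp [h0] at h
    have hv' : 0 < w 4 := hv.lt_of_ne' hv0
    have hx : 0 < w 0 := by nlinarith
    rw [show w 4 * w 0 - 1 = 0 by linarith]
    simp only [zero_mul, mul_zero, zero_add, add_zero]
    have : 0 < c ^ 2 * w 0 + 1 := by positivity
    positivity

/-- The images of the direction `e` (along `y` if `y ≠ 0`, otherwise along `x`) and of the `v` and
`u` directions form a triangular matrix with diagonal entries `d`, `-k`, `1`, all nonzero. -/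
theorem surjective_fderiv_exampleMap {w : Fin 5 → ℝ} (hw : w ∈ exampleMap ⁻¹' exampleArc) :
    Function.Surjective (fderiv ℝ exampleMap w) := by
  obtain ⟨c, hc, hw⟩ := hw
  obtain ⟨e, d, hd, he⟩ : ∃ (e : Fin 5 → ℝ) (d : ℝ), d ≠ 0 ∧
      fderiv ℝ exampleMap w e = ![d, 0, 0] := by
    by_cases hy : w 1 = 0
    · exact ⟨_, _, exampleMapDx_ne_zero hc.1 hc.2 hw hy, fderiv_exampleMap_x w⟩
    · exact ⟨_, _, mul_ne_zero two_ne_zero hy, fderiv_exampleMap_y w⟩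
  have hv1 := fderiv_exampleMap_v_one w
  have hv2 := fderiv_exampleMap_v_two w
  have hu2 := fderiv_exampleMap_u_two w
  have hk : (w 3 ^ 2 + 1) * (w 2 ^ 2 + 1) ≠ 0 := by positivity
  generalize (w 3 ^ 2 + 1) * (w 2 ^ 2 + 1) = k at *
  generalize fderiv ℝ exampleMap w = L at *
  generalize (![0, 0, 0, 0, 1] : Fin 5 → ℝ) = ev at *
  generalize (![0, 0, 0, 1, 0] : Fin 5 → ℝ) = eu at *
  intro b
  set β := (b 2 * L eu 1 - b 1) / k with hβ
  refine ⟨((b 0 - b 2 * L eu 0 - β * L ev 0) / d) • e + β • ev + b 2 • eu, ?_⟩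
  ext i
  rw [map_add, map_add, map_smul, map_smul, map_smul, he]
  fin_cases i
  · change (b 0 - b 2 * L eu 0 - β * L ev 0) / d * d + β * L ev 0 + b 2 * L eu 0 = b 0
    field_simp
    ring
  · change (b 0 - b 2 * L eu 0 - β * L ev 0) / d * 0 + β * L ev 1 + b 2 * L eu 1 = b 1
    rw [hv1, hβ]
    field_simp
    ring
  · change (b 0 - b 2 * L eu 0 - β * L ev 0) / d * 0 + β * L ev 2 + b 2 * L eu 2 = b 2
    rw [hv2, hu2]
    ring

/-! ### Application to the example. -/

theorem exists_homology_iso {X Y : Set (Fin 5 → ℝ)} (h : X ≃ₜ Y) (n : ℕ) :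
    Nonempty (integralHomology n X ≅ integralHomology n Y) :=
  ⟨((AlgebraicTopology.singularHomologyFunctor (ModuleCat.{0} ℤ) n).obj
    (ModuleCat.of ℤ ℤ)).mapIso (TopCat.isoOfHomeo h)⟩

theorem isPathConnected_cylinder : IsPathConnected cylinder := by
  have : IsPathConnected (Metric.sphere (0 : ℂ) 1) :=
    isPathConnected_sphere (by simp [Complex.rank_real_complex]) _ zero_le_one
  exact this.prod isPathConnected_univ

theorem isPathConnected_zero_fiber : IsPathConnected (exampleMap ⁻¹' {0}) := by
  obtain ⟨h⟩ := diffeomorphic_zero_fiber.nonempty_homeomorph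
  rw [← zero_eq_vec] at h
  have := isPathConnected_iff_pathConnectedSpace.1 isPathConnected_cylinder
  exact isPathConnected_iff_pathConnectedSpace.2
    (h.symm.surjective.pathConnectedSpace h.symm.continuous)

theorem diffeomorphic_fiber {t : Fin 3 → ℝ} (ht : t ∈ exampleArc) :
    DiffeomorphicSubsets (exampleMap ⁻¹' {t}) cylinder := by
  obtain ⟨c, hc, rfl⟩ := ht
  rcases hc.1.eq_or_lt with rfl | h
  · exact diffeomorphic_zero_fiber
  · exact diffeomorphic_fiber_of_pos h hc.2

theorem isEssentialDisc_exampleDisc {ε : ℝ} (hε : 0 < ε) (hε1 : ε ≤ 1) :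
    IsEssentialDisc (exampleMap ⁻¹' {0}) exampleDetector (exampleDisc ε) where
  continuousOn := continuousOn_exampleDetector
  ne_zero _ hw := exampleDetector_ne_zero hw
  continuous := continuous_exampleDisc hε
  mem ζ hζ := by
    rw [Set.mem_preimage, exampleMap_exampleDisc hε hε1, discHeight_eq_zero ε hζ, zero_eq_vec]
    rfl
  apply _ hζ := exampleDetector_exampleDisc hε hζ

theorem exampleDisc_mem {ε : ℝ} (hε : 0 < ε) (hε1 : ε ≤ 1) (ζ : ℂ) :
    exampleDisc ε ζ ∈ exampleMap ⁻¹' exampleArc :=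
  ⟨discHeight ε ζ, ⟨(discHeight_mem hε ζ).1, (discHeight_mem hε ζ).2.trans hε1⟩,
    exampleMap_exampleDisc hε hε1 ζ⟩

theorem IsEssentialDisc.codRestrict {X : Type*} [TopologicalSpace X] {A : Set X} {φ : X → ℂ}
    {G : ℂ → X} (h : IsEssentialDisc A φ G) {T : Set X} (hT : ∀ ζ, G ζ ∈ T) :
    IsEssentialDisc ((↑) ⁻¹' A : Set T) (fun x => φ x) (fun ζ => ⟨G ζ, hT ζ⟩) where
  continuousOn := h.continuousOn.comp continuous_subtype_val.continuousOn fun _ hx => hx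
  ne_zero x hx := h.ne_zero x hx
  continuous := h.continuous.subtype_mk _
  mem := h.mem
  apply := h.apply

theorem exists_exampleDisc_mem {W : Set (Fin 3 → ℝ)} (hW : W ∈ 𝓝 0) :
    ∃ ε, 0 < ε ∧ ε ≤ 1 ∧ ∀ ζ, exampleMap (exampleDisc ε ζ) ∈ W := by
  obtain ⟨r, hr, hrW⟩ := Metric.mem_nhds_iff.1 hW
  have hε : 0 < min 1 (r / 2) := lt_min one_pos (half_pos hr)
  refine ⟨_, hε, min_le_left _ _, fun ζ => hrW ?_⟩
  have hu := discHeight_mem hε ζ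
  rw [exampleMap_exampleDisc hε (min_le_left _ _), mem_ball_zero_iff, pi_norm_lt_iff hr]
  intro i
  fin_cases i
  · simpa using hr
  · simpa using hr
  · change |discHeight _ ζ| < r
    rw [abs_of_nonneg hu.1]
    exact hu.2.trans_lt ((min_le_right _ _).trans_lt (half_lt_self hr))

/-- The linear contraction of the arc to its endpoint. -/
noncomputable def arcContraction : C(I × exampleArc, exampleArc) where
  toFun s := ⟨(1 - (s.1 : ℝ)) • (s.2 : Fin 3 → ℝ), by
    obtain ⟨⟨t, ht⟩, ⟨_, ⟨u, hu, rfl⟩⟩⟩ := s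
    refine ⟨(1 - t) * u, ⟨mul_nonneg (sub_nonneg.2 ht.2) hu.1,
      mul_le_one₀ (by linarith [ht.1]) hu.1 hu.2⟩, ?_⟩
    ext i
    fin_cases i <;> simp⟩
  continuous_toFun := by fun_prop

theorem zeroFiber_eq_preimage :
    exampleZeroFiber = exampleRestriction ⁻¹' {⟨0, zero_mem_exampleArc⟩} := by
  ext w
  exact (Subtype.ext_iff (a1 := exampleRestriction w) (a2 := ⟨0, zero_mem_exampleArc⟩)).symm

theorem isEssentialDisc_restriction {ε : ℝ} (hε : 0 < ε) (hε1 : ε ≤ 1) :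
    IsEssentialDisc exampleZeroFiber (fun w => exampleDetector w)
      (fun ζ => ⟨exampleDisc ε ζ, exampleDisc_mem hε hε1 ζ⟩) :=
  (isEssentialDisc_exampleDisc hε hε1).codRestrict (exampleDisc_mem hε hε1)

theorem isPathConnected_exampleZeroFiber : IsPathConnected exampleZeroFiber := by
  refine isPathConnected_zero_fiber.preimage_coe fun w hw => ?_
  change exampleMap w ∈ exampleArc
  rw [show exampleMap w = 0 from hw]
  exact zero_mem_exampleArc

theorem mainTheorem3 :
    (∀ w ∈ exampleMap ⁻¹' exampleArc, Function.Surjective (fderiv ℝ exampleMap w)) ∧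
    (∀ t ∈ exampleArc, DiffeomorphicSubsets (exampleMap ⁻¹' {t}) cylinder) ∧
    (∀ t ∈ exampleArc, ∀ n : ℕ,
      Nonempty (integralHomology n (exampleMap ⁻¹' {t}) ≅
        integralHomology n (exampleMap ⁻¹' {0}))) ∧
    (∀ x₀ : exampleZeroFiber, Nontrivial (RelPi2 exampleZeroFiber x₀)) ∧
    ¬ IsSerreFibration exampleRestriction ∧
    IsAtypicalFiber exampleRestriction ⟨0, zero_mem_exampleArc⟩ ∧
    IsAtypicalFiber exampleMap 0 := by
  refine ⟨fun w => surjective_fderiv_exampleMap, fun t => diffeomorphic_fiber, fun t ht n => ?_, fun x₀ => ?_, ?_, ?_, ?_⟩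
  · obtain ⟨h⟩ := (diffeomorphic_fiber ht).nonempty_homeomorph
    obtain ⟨h'⟩ := (diffeomorphic_fiber zero_mem_exampleArc).nonempty_homeomorph
    exact exists_homology_iso (h.trans h'.symm) n
  · exact (isEssentialDisc_restriction one_pos le_rfl).nontrivial_relPi2
      isPathConnected_exampleZeroFiber x₀
  · have h := isEssentialDisc_restriction one_pos le_rfl
    rw [zeroFiber_eq_preimage] at h
    refine h.not_isSerreFibration arcContraction (fun x => ?_) (fun x => ?_) fun t => ?_
    · exact Subtype.ext (by simp [arcContraction])
    · exact Subtype.ext (by simp [arcContraction])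
    · exact Subtype.ext (by simp [arcContraction])
  · refine isAtypicalFiber_of_essentialDisc (φ := fun w => exampleDetector w) fun W hW => ?_
    obtain ⟨W', hW', hsub⟩ := mem_nhds_subtype _ _ _ |>.1 hW
    obtain ⟨ε, hε, hε1, h⟩ := exists_exampleDisc_mem hW'
    have h' := isEssentialDisc_restriction hε hε1
    rw [zeroFiber_eq_preimage] at h'
    exact ⟨_, h', fun ζ => hsub (h ζ)⟩
  · refine isAtypicalFiber_of_essentialDisc (φ := exampleDetector) fun W hW => ?_
    obtain ⟨ε, hε, hε1, h⟩ := exists_exampleDisc_mem hW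
    exact ⟨_, isEssentialDisc_exampleDisc hε hε1, h⟩
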